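/- Let $J\subseteq\mathbb R$ be a nonempty open interval, $(S,h)$ a connected smooth Riemannian manifold (of finite dimension $n$), and $f\colon J\to(0,\infty)$ a smooth function. Consider the generalized Robertson--Walker spacetime $$(M,g)=(J\times S,\ -dt^2+f(t)^2h),$$ time-oriented by $\partial_t$. Let $\tau(t,x)=\phi(t)$, where $\phi\colon J\to\mathbb R$ is smooth with $\phi'(t)>0$ for all $t\in J$. Then $\tau$ is a smooth temporal function, i.e. its gradient $\nabla\tau$ (defined by $g(\nabla\tau,X)=d\tau(X)$ for all $X$) is everywhere past-directed timelike. For each $t\in J$ let $M_t=\tau^{-1}(\phi(t))=\{t\}\times S$. Then $g(\nabla\tau,\nabla\tau)=-\phi'(t)^2$ at every point of $M_t$, the metric $h_t$ induced by $g$ on $M_t$ is positive definite, and for all $p,q\in M_t$ $$\hat d_\tau(p,q)\ \le\ \phi'(t)\,d_{h_t}(p,q).$$ Here $d_{h_t}$ is the Riemannian distance of $(M_t,h_t)$, and $\hat d_\tau$ is the null distance: $\hat d_\tau(p,p)=0$, and for $p\neq q$ $$\hat d_\tau(p,q)=\inf_\beta\ \sum_{i=0}^{N-1}\bigl|\tau(\beta(s_{i+1}))-\tau(\beta(s_i))\bigr|,$$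 where the infimum is over all curves $\beta\colon[a,b]\to M$ from $p$ to $q$ with a partition $a=s_0<\dots<s_N=b$ such that each restriction $\beta|_{[s_i,s_{i+1}]}$ is a smooth future-directed causal curve or a smooth past-directed causal curve. -/

import Mathlib

open Set Bundle Manifold MeasureTheory
open scoped Manifold ContDiff Topology ENNReal

set_option linter.unusedSectionVars false

noncomputable section

namespace NullDist

section General

variable {E : Type*} [NormedAddCommGroup E] [NormedSpace ℝ E]
  {H : Type*} [TopologicalSpace H] (I : ModelWithCorners ℝ E H)
  (M : Type*) [TopologicalSpace M] [ChartedSpace H M] [IsManifold I ∞ M]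

/-- A smooth Lorentzian metric on `M`: a smooth field of symmetric bilinear forms of signature
`(1, n)`. The signature condition says that some vector `v` is timelike and the form is positive
definite on the orthogonal complement of `v`. -/
structure LorentzianMetric where
  /-- the bilinear form on each tangent space -/
  val (p : M) : TangentSpace I p →L[ℝ] TangentSpace I p →L[ℝ] ℝ
  symm (p : M) (v w : TangentSpace I p) : val p v w = val p w v
  signature (p : M) : ∃ v : TangentSpace I p, val p v v < 0 ∧
    ∀ w : TangentSpace I p, val p v w = 0 → w ≠ 0 → 0 < val p w w
  contMDiff : ContMDiff I (I.prod 𝓘(ℝ, E →L[ℝ] E →L[ℝ] ℝ)) ∞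
    (fun p ↦ TotalSpace.mk' (E →L[ℝ] E →L[ℝ] ℝ) p (val p))

/-- A spacetime: a connected Lorentzian manifold with a time orientation, that is, a smooth
timelike vector field. -/
structure Spacetime extends LorentzianMetric I M where
  connected : ConnectedSpace M
  /-- the time orientation -/
  orient (p : M) : TangentSpace I p
  orient_timelike (p : M) : val p (orient p) (orient p) < 0
  orient_contMDiff : ContMDiff I I.tangent ∞
    (fun p ↦ (⟨p, orient p⟩ : TangentBundle I M))

variable {I M}

namespace Spacetime

variable (g : Spacetime I M)

/-- The norm `√|g(X, X)|`. -/
def norm {p : M} (X : TangentSpace I p) : ℝ := √|g.val p X X|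

def IsTimelike {p : M} (X : TangentSpace I p) : Prop := g.val p X X < 0

/-- Timelike or null; null vectors are non-zero. -/
def IsCausal {p : M} (X : TangentSpace I p) : Prop := X ≠ 0 ∧ g.val p X X ≤ 0

def IsFutureCausal {p : M} (X : TangentSpace I p) : Prop :=
  g.IsCausal X ∧ g.val p X (g.orient p) < 0

def IsPastCausal {p : M} (X : TangentSpace I p) : Prop :=
  g.IsCausal X ∧ 0 < g.val p X (g.orient p)

/-- `V` is the gradient of `f` at `p`: `g(V, X) = df(X)` for all `X`. -/
def IsGradientAt (f : M → ℝ) (p : M) (V : TangentSpace I p) : Prop :=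
  ∀ X : TangentSpace I p, g.val p V X = mfderiv I 𝓘(ℝ, ℝ) f p X

/-- A temporal function: differentiable, with everywhere past-directed timelike gradient. -/
def IsTemporal (f : M → ℝ) : Prop :=
  MDifferentiable I 𝓘(ℝ, ℝ) f ∧ ∀ p : M, ∃ V : TangentSpace I p,
    g.IsGradientAt f p V ∧ g.IsTimelike V ∧ g.IsPastCausal V

end Spacetime

variable (I) in
/-- The velocity at parameter `s` of a curve `γ` defined on `[a, b]` (one-sided at `a` and `b`;
values of `γ` outside `[a, b]` are irrelevant). -/
def velocity (γ : ℝ → M) (a b s : ℝ) : TangentSpace I (γ s) :=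
  mfderivWithin 𝓘(ℝ, ℝ) I γ (Icc a b) s (1 : ℝ)

namespace Spacetime

variable (g : Spacetime I M)

/-- `γ` restricted to `[a, b]` is a smooth future-directed causal curve. -/
def IsFutureCausalCurve (γ : ℝ → M) (a b : ℝ) : Prop :=
  ContMDiffOn 𝓘(ℝ, ℝ) I ∞ γ (Icc a b) ∧
    ∀ s ∈ Icc a b, g.IsFutureCausal (velocity I γ a b s)

/-- `γ` restricted to `[a, b]` is a smooth past-directed causal curve. -/
def IsPastCausalCurve (γ : ℝ → M) (a b : ℝ) : Prop :=
  ContMDiffOn 𝓘(ℝ, ℝ) I ∞ γ (Icc a b) ∧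
    ∀ s ∈ Icc a b, g.IsPastCausal (velocity I γ a b s)

/-- `β : [s 0, s N] → M` is a piecewise causal curve with breakpoints `s 0 < ⋯ < s N`. -/
def IsPiecewiseCausal (β : ℝ → M) (N : ℕ) (s : ℕ → ℝ) : Prop :=
  0 < N ∧ ∀ i < N, s i < s (i + 1) ∧
    (g.IsFutureCausalCurve β (s i) (s (i + 1)) ∨ g.IsPastCausalCurve β (s i) (s (i + 1)))

/-- The null length of a piecewise causal curve with breakpoints `s 0 < ⋯ < s N`. -/
def nullLength (τ : M → ℝ) (β : ℝ → M) (N : ℕ) (s : ℕ → ℝ) : ℝ :=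
  ∑ i ∈ Finset.range N, |τ (β (s (i + 1))) - τ (β (s i))|

open scoped Classical in
/-- The null distance: the infimum of the null lengths of the piecewise causal curves from `p` to
`q`, and `0` if `p = q`. The infimum is taken in `[0, ∞]`. -/
def nullDist (τ : M → ℝ) (p q : M) : ℝ≥0∞ :=
  if p = q then 0 else
    sInf {L : ℝ≥0∞ | ∃ (β : ℝ → M) (N : ℕ) (s : ℕ → ℝ), g.IsPiecewiseCausal β N s ∧
      β (s 0) = p ∧ β (s N) = q ∧ L = ENNReal.ofReal (nullLength τ β N s)}

/-- The distance of the induced metric on a spacelike embedded submanifold `N` of `M`: the infimum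
of the lengths `∫ √g(γ', γ')` of the `C¹` curves in `N` from `p` to `q`. (A curve in `N` is `C¹`
for the submanifold structure iff it is `C¹` as a curve in `M`, and its length for the induced
metric is the integral of the `g`-norm of its velocity.) The infimum is taken in `[0, ∞]`. -/
def inducedDist (N : Set M) (p q : M) : ℝ≥0∞ :=
  sInf {L : ℝ≥0∞ | ∃ γ : ℝ → M, ContMDiffOn 𝓘(ℝ, ℝ) I 1 γ (Icc 0 1) ∧
    (∀ s ∈ Icc (0 : ℝ) 1, γ s ∈ N) ∧ γ 0 = p ∧ γ 1 = q ∧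
    L = ∫⁻ s in Icc (0 : ℝ) 1, ENNReal.ofReal (g.norm (velocity I γ 0 1 s))}

end Spacetime

theorem contMDiffAt_clm_of_apply {F : Type*} [NormedAddCommGroup F] [NormedSpace ℝ F]
    {D : Type*} [NormedAddCommGroup D] [NormedSpace ℝ D] [FiniteDimensional ℝ D]
    {Φ : M → D →L[ℝ] F} {p₀ : M}
    (hΦ : ∀ y, ContMDiffAt I 𝓘(ℝ, F) ∞ (fun p ↦ Φ p y) p₀) :
    ContMDiffAt I 𝓘(ℝ, D →L[ℝ] F) ∞ Φ p₀ := by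
  let d := Module.finrank ℝ D
  have hd : d = Module.finrank ℝ (Fin d → ℝ) := (Module.finrank_fin_fun ℝ).symm
  let e₁ := ContinuousLinearEquiv.ofFinrankEq hd
  let e₂ := (e₁.arrowCongr (1 : F ≃L[ℝ] F)).trans (ContinuousLinearEquiv.piRing (Fin d))
  rw [← Function.id_comp Φ, ← e₂.symm_comp_self]
  exact e₂.symm.contDiff.contMDiff.contMDiffAt.comp p₀
    (contMDiffAt_pi_space.mpr fun i => hΦ _)

/-- A field of bilinear forms is smooth if it is smooth when evaluated on smooth local vector
fields. -/
theorem contMDiff_bilin [FiniteDimensional ℝ E]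
    (B : ∀ p : M, TangentSpace I p →L[ℝ] TangentSpace I p →L[ℝ] ℝ)
    (hB : ∀ (p₀ : M) (X Y : ∀ p : M, TangentSpace I p),
      ContMDiffAt I I.tangent ∞ (fun p ↦ (⟨p, X p⟩ : TangentBundle I M)) p₀ →
      ContMDiffAt I I.tangent ∞ (fun p ↦ (⟨p, Y p⟩ : TangentBundle I M)) p₀ →
      ContMDiffAt I 𝓘(ℝ, ℝ) ∞ (fun p ↦ B p (X p) (Y p)) p₀) :
    ContMDiff I (I.prod 𝓘(ℝ, E →L[ℝ] E →L[ℝ] ℝ)) ∞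
      (fun p ↦ TotalSpace.mk' (E →L[ℝ] E →L[ℝ] ℝ) p (B p)) := by
  intro p₀
  let e := trivializationAt E (TangentSpace I : M → Type _) p₀
  have hp₀ : p₀ ∈ e.baseSet := mem_baseSet_trivializationAt E _ p₀
  have hX (a : E) : ContMDiffAt I I.tangent ∞
      (fun p ↦ (⟨p, e.symm p a⟩ : TangentBundle I M)) p₀ := by
    rw [e.contMDiffAt_section_iff hp₀]
    refine (contMDiffAt_const (c := a)).congr_of_eventuallyEq ?_
    filter_upwards [e.open_baseSet.mem_nhds hp₀] with p hp
    rw [e.apply_mk_symm hp]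
  rw [contMDiffAt_section]
  refine contMDiffAt_clm_of_apply fun a ↦ contMDiffAt_clm_of_apply fun b ↦ ?_
  refine (hB p₀ _ _ (hX a) (hX b)).congr_of_eventuallyEq ?_
  filter_upwards [e.open_baseSet.mem_nhds hp₀] with p hp
  have hp' : p ∈ (trivializationAt (E →L[ℝ] ℝ) (fun x ↦ TangentSpace I x →L[ℝ] ℝ) p₀).baseSet := by
    rw [hom_trivializationAt_baseSet]
    exact ⟨hp, mem_univ _⟩
  rw [hom_trivializationAt_apply]
  simp [ContinuousLinearMap.inCoordinates, Trivialization.coe_linearMapAt_of_mem _ hp',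
    hom_trivializationAt_apply, Trivialization.symmL_apply _ hp, e]

end General

section GRW

variable {E : Type*} [NormedAddCommGroup E] [NormedSpace ℝ E]
  {S : Type*} [TopologicalSpace S] [ChartedSpace E S] [IsManifold 𝓘(ℝ, E) ∞ S]

/-- The differential `dt` on `T_{(t, x)}(J × S) = T_t J × T_x S = ℝ × T_x S`. -/
def dt {J : TopologicalSpace.Opens ℝ} (p : J × S) :
    TangentSpace (𝓘(ℝ, ℝ).prod 𝓘(ℝ, E)) p →L[ℝ] ℝ :=
  ContinuousLinearMap.fst ℝ ℝ E

/-- The differential of the projection `J × S → S`. -/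
def dx {J : TopologicalSpace.Opens ℝ} (p : J × S) :
    TangentSpace (𝓘(ℝ, ℝ).prod 𝓘(ℝ, E)) p →L[ℝ] TangentSpace 𝓘(ℝ, E) p.2 :=
  ContinuousLinearMap.snd ℝ ℝ E

/-- The coordinate vector field `∂_t` on `J × S`. -/
def partialT {J : TopologicalSpace.Opens ℝ} (p : J × S) :
    TangentSpace (𝓘(ℝ, ℝ).prod 𝓘(ℝ, E)) p :=
  ((1 : ℝ), (0 : E))

/-- The bilinear form `-dt² + f(t)² h` on the tangent space of `J × S` at `p = (t, x)`. -/
def grwForm (J : TopologicalSpace.Opens ℝ) (f : ℝ → ℝ)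
    (h : ContMDiffRiemannianMetric 𝓘(ℝ, E) ∞ E (fun x : S ↦ TangentSpace 𝓘(ℝ, E) x))
    (p : J × S) : TangentSpace (𝓘(ℝ, ℝ).prod 𝓘(ℝ, E)) p →L[ℝ]
      TangentSpace (𝓘(ℝ, ℝ).prod 𝓘(ℝ, E)) p →L[ℝ] ℝ :=
  letI a : ℝ × E →L[ℝ] ℝ := dt p
  letI b : ℝ × E →L[ℝ] E := dx p
  letI k : E →L[ℝ] E →L[ℝ] ℝ := h.inner p.2
  letI B : ℝ × E →L[ℝ] ℝ × E →L[ℝ] ℝ :=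
    -((ContinuousLinearMap.mul ℝ ℝ).bilinearComp a a) + (f p.1 ^ 2) • k.bilinearComp b b
  B

theorem grwForm_apply (J : TopologicalSpace.Opens ℝ) (f : ℝ → ℝ)
    (h : ContMDiffRiemannianMetric 𝓘(ℝ, E) ∞ E (fun x : S ↦ TangentSpace 𝓘(ℝ, E) x))
    (p : J × S) (v w : TangentSpace (𝓘(ℝ, ℝ).prod 𝓘(ℝ, E)) p) :
    grwForm J f h p v w = -(dt p v * dt p w) + f p.1 ^ 2 * h.inner p.2 (dx p v) (dx p w) :=
  rfl

theorem dt_partialT {J : TopologicalSpace.Opens ℝ} (p : J × S) :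
    dt p (partialT (E := E) p) = 1 := rfl

theorem dx_partialT {J : TopologicalSpace.Opens ℝ} (p : J × S) :
    dx p (partialT (E := E) p) = 0 := rfl

theorem eq_zero_of_dt_dx {J : TopologicalSpace.Opens ℝ} {p : J × S}
    {v : TangentSpace (𝓘(ℝ, ℝ).prod 𝓘(ℝ, E)) p} (h1 : dt p v = 0) (h2 : dx p v = 0) : v = 0 :=
  Prod.ext h1 h2

theorem trivializationAt_opens (J : TopologicalSpace.Opens ℝ) (t₀ : J)
    (z : TangentBundle 𝓘(ℝ, ℝ) J) :
    (trivializationAt ℝ (TangentSpace 𝓘(ℝ, ℝ) : J → Type _) t₀ z).2 = z.2 := by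
  rw [TangentBundle.trivializationAt_apply]
  have hev : (chartAt ℝ t₀ ∘ (chartAt ℝ z.proj).symm) =ᶠ[𝓝 (chartAt ℝ z.proj z.proj)] id := by
    filter_upwards [(chartAt ℝ z.proj).open_target.mem_nhds (mem_chart_target ℝ z.proj)] with y hy
    exact (chartAt ℝ z.proj).right_inv hy
  have hd : fderiv ℝ (chartAt ℝ t₀ ∘ (chartAt ℝ z.proj).symm) (chartAt ℝ z.proj z.proj) =
      ContinuousLinearMap.id ℝ ℝ := by
    rw [hev.fderiv_eq, fderiv_id]
  simp only [mfld_simps, fderivWithin_univ]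
  exact congrArg (fun L : ℝ →L[ℝ] ℝ ↦ L z.2) hd

theorem contMDiffAt_fst_component (J : TopologicalSpace.Opens ℝ) (p₀ : J × S)
    {X : ∀ p : J × S, TangentSpace (𝓘(ℝ, ℝ).prod 𝓘(ℝ, E)) p}
    (hX : ContMDiffAt (𝓘(ℝ, ℝ).prod 𝓘(ℝ, E)) (𝓘(ℝ, ℝ).prod 𝓘(ℝ, E)).tangent ∞
      (fun p ↦ (⟨p, X p⟩ : TangentBundle (𝓘(ℝ, ℝ).prod 𝓘(ℝ, E)) (J × S))) p₀) :
    ContMDiffAt (𝓘(ℝ, ℝ).prod 𝓘(ℝ, E)) 𝓘(ℝ, ℝ) ∞ (fun p ↦ dt p (X p)) p₀ := by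
  have h := contMDiffAt_fst.comp p₀ (contMDiff_equivTangentBundleProd.contMDiffAt.comp p₀ hX)
  rw [contMDiffAt_totalSpace] at h
  refine h.2.congr_of_eventuallyEq (Filter.Eventually.of_forall fun p ↦ ?_)
  exact (trivializationAt_opens J p₀.1 ⟨p.1, dt p (X p)⟩).symm

theorem contMDiff_partialT (J : TopologicalSpace.Opens ℝ) :
    ContMDiff (𝓘(ℝ, ℝ).prod 𝓘(ℝ, E)) (𝓘(ℝ, ℝ).prod 𝓘(ℝ, E)).tangent ∞
      (fun p : J × S ↦ (⟨p, partialT p⟩ :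
        TangentBundle (𝓘(ℝ, ℝ).prod 𝓘(ℝ, E)) (J × S))) := by
  have h1 : ContMDiff 𝓘(ℝ, ℝ) 𝓘(ℝ, ℝ).tangent ∞
      (fun t : J ↦ (⟨t, (1 : ℝ)⟩ : TangentBundle 𝓘(ℝ, ℝ) J)) := by
    intro t
    refine contMDiffAt_totalSpace.mpr ⟨contMDiffAt_id, ?_⟩
    refine (contMDiffAt_const (c := (1 : ℝ))).congr_of_eventuallyEq
      (Filter.Eventually.of_forall fun t ↦ ?_)
    exact trivializationAt_opens J _ ⟨t, (1 : ℝ)⟩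
  have h2 : ContMDiff 𝓘(ℝ, E) 𝓘(ℝ, E).tangent ∞
      (fun x : S ↦ (⟨x, (0 : E)⟩ : TangentBundle 𝓘(ℝ, E) S)) :=
    contMDiff_zeroSection ℝ (TangentSpace 𝓘(ℝ, E) : S → Type _)
  exact contMDiff_equivTangentBundleProd_symm.comp
    ((h1.comp contMDiff_fst).prodMk (h2.comp contMDiff_snd))

theorem contMDiff_grwForm [FiniteDimensional ℝ E]
    (J : TopologicalSpace.Opens ℝ) (f : ℝ → ℝ) (hf : ContDiffOn ℝ ∞ f J)
    (h : ContMDiffRiemannianMetric 𝓘(ℝ, E) ∞ E (fun x : S ↦ TangentSpace 𝓘(ℝ, E) x)) :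
    ContMDiff (𝓘(ℝ, ℝ).prod 𝓘(ℝ, E))
      ((𝓘(ℝ, ℝ).prod 𝓘(ℝ, E)).prod 𝓘(ℝ, ℝ × E →L[ℝ] ℝ × E →L[ℝ] ℝ)) ∞
      (fun p : J × S ↦ TotalSpace.mk' (ℝ × E →L[ℝ] ℝ × E →L[ℝ] ℝ) p (grwForm J f h p)) := by
  refine contMDiff_bilin (I := 𝓘(ℝ, ℝ).prod 𝓘(ℝ, E)) (grwForm J f h) fun p₀ X Y hX hY ↦ ?_
  simp only [grwForm_apply]
  have hf' : ContMDiffAt (𝓘(ℝ, ℝ).prod 𝓘(ℝ, E)) 𝓘(ℝ, ℝ) ∞ (fun p : J × S ↦ f p.1) p₀ := by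
    have h1 : ContMDiffAt 𝓘(ℝ, ℝ) 𝓘(ℝ, ℝ) ∞ f p₀.1 :=
      ((hf p₀.1 p₀.1.2).contDiffAt (J.2.mem_nhds p₀.1.2)).contMDiffAt
    exact ContMDiffAt.comp (f := fun p : J × S ↦ (p.1 : ℝ)) p₀ h1
      (contMDiff_subtype_val.contMDiffAt.comp p₀ contMDiffAt_fst)
  have hX2 := contMDiffAt_snd.comp p₀ (contMDiff_equivTangentBundleProd.contMDiffAt.comp p₀ hX)
  have hY2 := contMDiffAt_snd.comp p₀ (contMDiff_equivTangentBundleProd.contMDiffAt.comp p₀ hY)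
  have hh : ContMDiffAt (𝓘(ℝ, ℝ).prod 𝓘(ℝ, E)) 𝓘(ℝ, ℝ) ∞
      (fun p : J × S ↦ h.inner p.2 (dx p (X p)) (dx p (Y p))) p₀ := by
    have : ContMDiffAt (𝓘(ℝ, ℝ).prod 𝓘(ℝ, E)) (𝓘(ℝ, E).prod 𝓘(ℝ, ℝ)) ∞
        (fun p : J × S ↦ TotalSpace.mk' ℝ (E := Bundle.Trivial S ℝ) p.2
          (h.inner p.2 (dx p (X p)) (dx p (Y p)))) p₀ := by
      apply ContMDiffAt.clm_bundle_apply₂ (F₁ := E) (F₂ := E)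
        (E₁ := fun x : S ↦ TangentSpace 𝓘(ℝ, E) x) (E₂ := fun x : S ↦ TangentSpace 𝓘(ℝ, E) x)
      · exact ContMDiffAt.comp p₀ h.contMDiff.contMDiffAt contMDiffAt_snd
      · exact hX2
      · exact hY2
    rw [contMDiffAt_totalSpace] at this
    exact this.2
  exact ((contMDiffAt_fst_component J p₀ hX).mul (contMDiffAt_fst_component J p₀ hY)).neg.add
    ((hf'.pow 2).mul hh)

/-- The generalized Robertson--Walker spacetime `(J × S, -dt² + f(t)² h)`, time-oriented by
`∂_t`. Here `J` is a non-empty open interval and `(S, h)` a connected Riemannian manifold. -/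
def grw [FiniteDimensional ℝ E] [ConnectedSpace S]
    (J : TopologicalSpace.Opens ℝ) (hJ : (J : Set ℝ).OrdConnected)
    (hne : (J : Set ℝ).Nonempty) (f : ℝ → ℝ) (hf : ContDiffOn ℝ ∞ f J) (hpos : ∀ t ∈ J, 0 < f t)
    (h : ContMDiffRiemannianMetric 𝓘(ℝ, E) ∞ E (fun x : S ↦ TangentSpace 𝓘(ℝ, E) x)) :
    Spacetime (𝓘(ℝ, ℝ).prod 𝓘(ℝ, E)) (J × S) where
  val := grwForm J f h
  symm p v w := by
    rw [grwForm_apply, grwForm_apply, h.symm, mul_comm (dt p v)]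
  signature p := by
    refine ⟨partialT p, ?_, fun w hw hw0 ↦ ?_⟩
    · simp [grwForm_apply, dt_partialT, dx_partialT]
    · simp only [grwForm_apply, dt_partialT, dx_partialT, map_zero, one_mul,
        zero_apply, mul_zero, add_zero, neg_eq_zero] at hw
      have h2 : dx p w ≠ 0 := fun h2 ↦ hw0 (eq_zero_of_dt_dx hw h2)
      have h3 := h.pos p.2 _ h2
      have h4 := hpos p.1 p.1.2
      rw [grwForm_apply, hw]
      simp only [mul_zero, neg_zero, zero_add]
      positivity
  contMDiff := contMDiff_grwForm J f hf h
  connected := by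
    have : ConnectedSpace J :=
      isConnected_iff_connectedSpace.mp ⟨hne, isPreconnected_iff_ordConnected.mpr hJ⟩
    exact inferInstanceAs (ConnectedSpace (J × S))
  orient := partialT
  orient_timelike p := by
    simp [grwForm_apply, dt_partialT, dx_partialT]
  orient_contMDiff := contMDiff_partialT J

end GRW

end NullDist

end

/-! The gradient of `φ(t)` is `-φ' ∂_t`, which settles everything except the distance estimate. For
that estimate, take a `C¹` curve `x` in `S`, placed at height `t`, and lift it to zigzags in time:
over a short parameter interval `[a, b]` climb with slope `k` up to the midpoint, then descend to
height `t` again. If `k` slightly exceeds the speed `f(t) |x'|_h`, both legs are causal, because `f`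
varies little over small heights. The null length of the zigzag is `2 (φ(t + k (b - a) / 2) -
φ(t))`, about `φ'(t) k (b - a)`. Over a fine partition these add up, with small error, to `φ'(t)`
times the length of the curve in `h_t`.

The legs must be smooth while `x` is only `C¹`. Inside a chart, `x` is therefore replaced by the
straight segment with the same endpoints. Its slope is close to the derivative of `x`
(`norm_slope_sub_le_of_derivWithin`), and continuity of the metric in coordinates
(`continuousAt_chartForm`) keeps the legs causal.

`causalChain_local` bounds the null length over every short interval by an integral over that
interval, with an error `δ` in the integrand. Such bounds are additive, so `CausalChain.of_local`
joins them by compactness, and `grw_nullDist_le_lintegral` lets `δ` tend to `0`. -/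

namespace NullDist

/-! ### The time function, its gradient and its level sets -/

section TimeFunction

variable {E : Type*} [NormedAddCommGroup E] [NormedSpace ℝ E]
  {S : Type*} [TopologicalSpace S] [ChartedSpace E S] [IsManifold 𝓘(ℝ, E) ∞ S]

/-- The charts of an open subset of `ℝ` are restrictions of the identity, so in coordinates the
inclusion is the identity near `t`. -/
theorem hasMFDerivAt_opens_val {J : TopologicalSpace.Opens ℝ} (t : J) :
    HasMFDerivAt 𝓘(ℝ, ℝ) 𝓘(ℝ, ℝ) (Subtype.val : J → ℝ) t (ContinuousLinearMap.id ℝ ℝ) := by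
  refine ⟨continuous_subtype_val.continuousAt, ?_⟩
  refine ((hasFDerivAt_id _).congr_of_eventuallyEq ?_).hasFDerivWithinAt
  filter_upwards [(chartAt ℝ t).open_target.mem_nhds (mem_chart_target ℝ t)] with y hy
  exact (chartAt ℝ t).right_inv hy

theorem hasMFDerivAt_time {J : TopologicalSpace.Opens ℝ} (p : J × S) :
    HasMFDerivAt (𝓘(ℝ, ℝ).prod 𝓘(ℝ, E)) 𝓘(ℝ, ℝ) (fun p : J × S ↦ (p.1 : ℝ)) p (dt p) :=
  (hasMFDerivAt_opens_val p.1).comp p (hasMFDerivAt_fst p)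

theorem hasMFDerivAt_comp_time {J : TopologicalSpace.Opens ℝ} {φ : ℝ → ℝ}
    (hφ : ContDiffOn ℝ ∞ φ J) (p : J × S) :
    HasMFDerivAt (𝓘(ℝ, ℝ).prod 𝓘(ℝ, E)) 𝓘(ℝ, ℝ) (fun p : J × S ↦ φ p.1) p
      (deriv φ p.1 • (dt p : ℝ × E →L[ℝ] ℝ)) := by
  have h1 : HasDerivAt φ (deriv φ p.1) p.1 :=
    (((hφ p.1 p.1.2).contDiffAt (J.2.mem_nhds p.1.2)).differentiableAt (by simp)).hasDerivAt
  have h2 := h1.hasFDerivAt.hasMFDerivAt.comp p (hasMFDerivAt_time (E := E) p)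
  have h3 : (deriv φ p.1 • (dt p : ℝ × E →L[ℝ] ℝ)) =
      (ContinuousLinearMap.toSpanSingleton ℝ (deriv φ p.1)).comp (dt p : ℝ × E →L[ℝ] ℝ) :=
    ContinuousLinearMap.ext fun v ↦ by simp [mul_comm]
  rw [h3]
  exact h2

theorem contMDiff_comp_time {J : TopologicalSpace.Opens ℝ} {φ : ℝ → ℝ}
    (hφ : ContDiffOn ℝ ∞ φ J) :
    ContMDiff (𝓘(ℝ, ℝ).prod 𝓘(ℝ, E)) 𝓘(ℝ, ℝ) ∞ (fun p : J × S ↦ φ p.1) := fun p ↦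
  ContMDiffAt.comp (f := fun p : J × S ↦ (p.1 : ℝ)) p
    ((hφ p.1 p.1.2).contDiffAt (J.2.mem_nhds p.1.2)).contMDiffAt
    (contMDiff_subtype_val.contMDiffAt.comp p contMDiffAt_fst)

theorem strictMonoOn_of_deriv_pos_opens {J : TopologicalSpace.Opens ℝ}
    (hJ : (J : Set ℝ).OrdConnected) {φ : ℝ → ℝ} (hφ : ContDiffOn ℝ ∞ φ J)
    (hφ' : ∀ t ∈ J, 0 < deriv φ t) : StrictMonoOn φ J :=
  strictMonoOn_of_deriv_pos hJ.convex hφ.continuousOn fun t ht ↦ hφ' t (interior_subset ht)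

variable [FiniteDimensional ℝ E] [ConnectedSpace S]
  (J : TopologicalSpace.Opens ℝ) (hJ : (J : Set ℝ).OrdConnected) (hne : (J : Set ℝ).Nonempty)
  (f : ℝ → ℝ) (hf : ContDiffOn ℝ ∞ f J) (hpos : ∀ t ∈ J, 0 < f t)
  (h : ContMDiffRiemannianMetric 𝓘(ℝ, E) ∞ E (fun x : S ↦ TangentSpace 𝓘(ℝ, E) x))

theorem grw_val_apply (p : J × S) (v w : TangentSpace (𝓘(ℝ, ℝ).prod 𝓘(ℝ, E)) p) :
    (grw J hJ hne f hf hpos h).val p v w =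
      -(dt p v * dt p w) + f p.1 ^ 2 * h.inner p.2 (dx p v) (dx p w) := rfl

theorem grw_val_partialT (p : J × S) (v : TangentSpace (𝓘(ℝ, ℝ).prod 𝓘(ℝ, E)) p) :
    (grw J hJ hne f hf hpos h).val p v (partialT p) = -dt p v := by
  rw [grw_val_apply, dt_partialT, dx_partialT]
  simp

theorem grw_isGradientAt_iff {φ : ℝ → ℝ} (hφ : ContDiffOn ℝ ∞ φ J)
    (p : J × S) (V : TangentSpace (𝓘(ℝ, ℝ).prod 𝓘(ℝ, E)) p) :
    (grw J hJ hne f hf hpos h).IsGradientAt (fun p : J × S ↦ φ p.1) p V ↔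
      ∀ X, (grw J hJ hne f hf hpos h).val p V X = deriv φ p.1 * dt p X := by
  unfold Spacetime.IsGradientAt
  rw [(hasMFDerivAt_comp_time hφ p).mfderiv]
  rfl

/-- This holds because `g(∂_t, X) = -dt(X)`, while `dτ = φ' dt`. -/
theorem grw_isGradientAt {φ : ℝ → ℝ} (hφ : ContDiffOn ℝ ∞ φ J) (p : J × S) :
    (grw J hJ hne f hf hpos h).IsGradientAt (fun p : J × S ↦ φ p.1) p
      ((-deriv φ p.1) • partialT p) := by
  rw [grw_isGradientAt_iff J hJ hne f hf hpos h hφ]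
  intro X
  rw [(grw J hJ hne f hf hpos h).symm, map_smul, grw_val_partialT]
  simp

/-- Pairing `V` with `∂_t` gives `dt(V) = -φ'`, and `g(V, V) = dτ(V) = φ' dt(V)`. Uniqueness of the
gradient is not needed. -/
theorem grw_val_gradient {φ : ℝ → ℝ} (hφ : ContDiffOn ℝ ∞ φ J)
    {p : J × S} {V : TangentSpace (𝓘(ℝ, ℝ).prod 𝓘(ℝ, E)) p}
    (hV : (grw J hJ hne f hf hpos h).IsGradientAt (fun p : J × S ↦ φ p.1) p V) :
    (grw J hJ hne f hf hpos h).val p V V = -(deriv φ p.1) ^ 2 := by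
  rw [grw_isGradientAt_iff J hJ hne f hf hpos h hφ] at hV
  have h1 := hV (partialT p)
  rw [grw_val_partialT, dt_partialT] at h1
  rw [hV V]
  linear_combination (-deriv φ p.1) * h1

theorem grw_isTemporal {φ : ℝ → ℝ} (hφ : ContDiffOn ℝ ∞ φ J)
    (hφ' : ∀ t ∈ J, 0 < deriv φ t) :
    (grw J hJ hne f hf hpos h).IsTemporal (fun p : J × S ↦ φ p.1) := by
  refine ⟨fun p ↦ (hasMFDerivAt_comp_time hφ p).mdifferentiableAt, fun p ↦
    ⟨_, grw_isGradientAt J hJ hne f hf hpos h hφ p, ?_⟩⟩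
  have h0 := hφ' p.1 p.1.2
  have h1 := grw_val_gradient J hJ hne f hf hpos h hφ (grw_isGradientAt J hJ hne f hf hpos h hφ p)
  have h2 : (grw J hJ hne f hf hpos h).val p ((-deriv φ p.1) • partialT p)
      ((-deriv φ p.1) • partialT p) < 0 := by
    rw [h1]
    nlinarith
  refine ⟨h2, ⟨fun h3 ↦ ?_, h2.le⟩, ?_⟩
  · rw [h3] at h2
    simp at h2
  · change 0 < (grw J hJ hne f hf hpos h).val p ((-deriv φ p.1) • partialT p) (partialT p)
    rw [grw_val_partialT, map_smul, dt_partialT]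
    simpa using h0

theorem grw_val_pos_of_dt_eq_zero {p : J × S} {X : TangentSpace (𝓘(ℝ, ℝ).prod 𝓘(ℝ, E)) p}
    (hX : dt p X = 0) (hX0 : X ≠ 0) : 0 < (grw J hJ hne f hf hpos h).val p X X := by
  have h3 := h.pos p.2 _ fun h2 ↦ hX0 (eq_zero_of_dt_dx hX h2)
  have h4 := hpos p.1 p.1.2
  rw [grw_val_apply, hX]
  simp only [mul_zero, neg_zero, zero_add]
  positivity

end TimeFunction

end NullDist

/-! ### Concatenation of piecewise causal curves -/

namespace NullDist

section CausalChain

variable {E : Type*} [NormedAddCommGroup E] [NormedSpace ℝ E]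
  {H : Type*} [TopologicalSpace H] {I : ModelWithCorners ℝ E H}
  {M : Type*} [TopologicalSpace M] [ChartedSpace H M] [IsManifold I ∞ M]

namespace Spacetime

variable (g : Spacetime I M)

/-- The velocity is a derivative within `[a, b]`, so it depends only on the values there. This makes
it possible to glue curves by cases. The base points `γ s` and `γ' s` are only propositionally
equal, hence the transport in `key`. -/
theorem isFutureCausal_velocity_congr {γ γ' : ℝ → M} {a b s : ℝ} (hs : s ∈ Icc a b)
    (h : EqOn γ γ' (Icc a b)) :
    g.IsFutureCausal (velocity I γ a b s) ↔ g.IsFutureCausal (velocity I γ' a b s) := by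
  have key : ∀ (p q : M) (_ : p = q) (v : E), g.IsFutureCausal (p := p) v ↔
      g.IsFutureCausal (p := q) v := by
    rintro p _ rfl v
    rfl
  have hv : (velocity I γ a b s : E) = (velocity I γ' a b s : E) :=
    congrArg (fun L : ℝ →L[ℝ] E ↦ L 1) (mfderivWithin_congr h (h hs))
  refine (key _ _ (h hs) _).trans ?_
  rw [hv]

theorem isPastCausal_velocity_congr {γ γ' : ℝ → M} {a b s : ℝ} (hs : s ∈ Icc a b)
    (h : EqOn γ γ' (Icc a b)) :
    g.IsPastCausal (velocity I γ a b s) ↔ g.IsPastCausal (velocity I γ' a b s) := by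
  have key : ∀ (p q : M) (_ : p = q) (v : E), g.IsPastCausal (p := p) v ↔
      g.IsPastCausal (p := q) v := by
    rintro p _ rfl v
    rfl
  have hv : (velocity I γ a b s : E) = (velocity I γ' a b s : E) :=
    congrArg (fun L : ℝ →L[ℝ] E ↦ L 1) (mfderivWithin_congr h (h hs))
  refine (key _ _ (h hs) _).trans ?_
  rw [hv]

variable {g}

theorem IsFutureCausalCurve.congr {γ γ' : ℝ → M} {a b : ℝ} (hγ : g.IsFutureCausalCurve γ a b)
    (h : EqOn γ' γ (Icc a b)) : g.IsFutureCausalCurve γ' a b :=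
  ⟨hγ.1.congr h, fun s hs ↦ (g.isFutureCausal_velocity_congr hs h).mpr (hγ.2 s hs)⟩

theorem IsPastCausalCurve.congr {γ γ' : ℝ → M} {a b : ℝ} (hγ : g.IsPastCausalCurve γ a b)
    (h : EqOn γ' γ (Icc a b)) : g.IsPastCausalCurve γ' a b :=
  ⟨hγ.1.congr h, fun s hs ↦ (g.isPastCausal_velocity_congr hs h).mpr (hγ.2 s hs)⟩

theorem IsPiecewiseCausal.le {β : ℝ → M} {N : ℕ} {s : ℕ → ℝ} (h : g.IsPiecewiseCausal β N s)
    {i j : ℕ} (hij : i ≤ j) (hj : j ≤ N) : s i ≤ s j := by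
  induction j, hij using Nat.le_induction with
  | base => exact le_rfl
  | succ j _ ih => exact (ih (by omega)).trans (h.2 j (by omega)).1.le

variable (g)

/-- There is a piecewise causal curve from `p` to `q` with parameter interval `[a, b]`, whose null
length is at most `L`. -/
def CausalChain (τ : M → ℝ) (p q : M) (a b : ℝ) (L : ℝ≥0∞) : Prop :=
  ∃ (β : ℝ → M) (N : ℕ) (s : ℕ → ℝ), g.IsPiecewiseCausal β N s ∧ s 0 = a ∧ s N = b ∧
    β a = p ∧ β b = q ∧ ENNReal.ofReal (nullLength τ β N s) ≤ L

variable {g} {τ : M → ℝ} {p q r : M} {a b c : ℝ} {L L' : ℝ≥0∞}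

theorem CausalChain.mono (h : g.CausalChain τ p q a b L) (hL : L ≤ L') :
    g.CausalChain τ p q a b L' := by
  obtain ⟨β, N, s, h1, h2, h3, h4, h5, h6⟩ := h
  exact ⟨β, N, s, h1, h2, h3, h4, h5, h6.trans hL⟩

theorem CausalChain.nullDist_le (h : g.CausalChain τ p q a b L) : g.nullDist τ p q ≤ L := by
  obtain ⟨β, N, s, h1, rfl, rfl, h4, h5, h6⟩ := h
  unfold nullDist
  split_ifs
  · exact zero_le
  · refine le_trans (sInf_le ?_) h6
    exact ⟨β, N, s, h1, h4, h5, rfl⟩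

theorem CausalChain.of_causalCurve {β : ℝ → M} (hab : a < b)
    (h : g.IsFutureCausalCurve β a b ∨ g.IsPastCausalCurve β a b) :
    g.CausalChain τ (β a) (β b) a b (ENNReal.ofReal |τ (β b) - τ (β a)|) := by
  refine ⟨β, 1, fun i ↦ if i = 0 then a else b, ⟨one_pos, fun i hi ↦ ?_⟩, rfl, rfl, rfl, rfl, ?_⟩
  · obtain rfl : i = 0 := by omega
    exact ⟨hab, h⟩
  · simp [nullLength]

/-- The two curves agree at the common parameter `b`, and causality of a piece depends only on its
closed parameter interval. No regularity is required at the joint, so the glued curve is piecewise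
causal and the null lengths add. -/
theorem CausalChain.trans (h : g.CausalChain τ p q a b L) (h' : g.CausalChain τ q r b c L') :
    g.CausalChain τ p r a c (L + L') := by
  obtain ⟨β, N, s, h1, h2, h3, h4, h5, h6⟩ := h
  obtain ⟨β', N', s', h1', h2', h3', h4', h5', h6'⟩ := h'
  let B : ℝ → M := fun x ↦ if x ≤ b then β x else β' x
  let σ : ℕ → ℝ := fun i ↦ if i ≤ N then s i else s' (i - N)
  have hB : ∀ x ≤ b, B x = β x := fun x hx ↦ if_pos hx
  have hB' : ∀ x, b ≤ x → B x = β' x := by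
    intro x hx
    rcases hx.eq_or_lt with rfl | hx
    · rw [hB _ le_rfl, h5, h4']
    · exact if_neg hx.not_ge
  have hσ : ∀ i ≤ N, σ i = s i := fun i hi ↦ if_pos hi
  have hσ' : ∀ j, σ (N + j) = s' j := by
    intro j
    rcases Nat.eq_zero_or_pos j with rfl | hj
    · rw [Nat.add_zero, hσ _ le_rfl, h3, h2']
    · simp only [σ]
      rw [if_neg (by omega), Nat.add_sub_cancel_left]
  have hle : ∀ i ≤ N, s i ≤ b := fun i hi ↦ h3 ▸ h1.le hi le_rfl
  have hle' : ∀ j ≤ N', b ≤ s' j := fun j hj ↦ h2' ▸ h1'.le (Nat.zero_le j) hj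
  refine ⟨B, N + N', σ, ⟨Nat.add_pos_left h1.1 _, fun i hi ↦ ?_⟩, ?_, ?_, ?_, ?_, ?_⟩
  · rcases lt_or_ge i N with hiN | hiN
    · rw [hσ i hiN.le, hσ (i + 1) hiN]
      have hE : EqOn B β (Icc (s i) (s (i + 1))) := fun x hx ↦ hB x (hx.2.trans (hle _ hiN))
      exact ⟨(h1.2 i hiN).1, (h1.2 i hiN).2.imp (fun h ↦ h.congr hE) fun h ↦ h.congr hE⟩
    · obtain ⟨j, rfl⟩ := Nat.exists_eq_add_of_le hiN
      have hj : j < N' := by omega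
      rw [add_assoc, hσ', hσ']
      have hE : EqOn B β' (Icc (s' j) (s' (j + 1))) :=
        fun x hx ↦ hB' x ((hle' j hj.le).trans hx.1)
      exact ⟨(h1'.2 j hj).1, (h1'.2 j hj).2.imp (fun h ↦ h.congr hE) fun h ↦ h.congr hE⟩
  · rw [hσ 0 (Nat.zero_le _), h2]
  · rw [hσ', h3']
  · rw [hB a (h2 ▸ hle 0 (Nat.zero_le _)), h4]
  · rw [hB' c (h3' ▸ hle' N' le_rfl), h5']
  · have hlen : nullLength τ B (N + N') σ = nullLength τ β N s + nullLength τ β' N' s' := by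
      unfold nullLength
      rw [Finset.sum_range_add]
      congr 1
      · refine Finset.sum_congr rfl fun i hi ↦ ?_
        have hi := Finset.mem_range.mp hi
        rw [hσ i hi.le, hσ (i + 1) hi, hB _ (hle _ hi.le), hB _ (hle _ hi)]
      · refine Finset.sum_congr rfl fun j hj ↦ ?_
        have hj := Finset.mem_range.mp hj
        rw [add_assoc, hσ', hσ', hB' _ (hle' _ hj.le), hB' _ (hle' _ hj)]
    rw [hlen]
    exact ENNReal.ofReal_add_le.trans (add_le_add h6 h6')

/-- Local causal chains along a curve can be joined to a global one. -/
theorem CausalChain.of_local {γ : ℝ → M} {w : ℝ → ℝ≥0∞} {C : ℝ≥0∞} (hab : a < b)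
    (hloc : ∀ s₀ ∈ Icc a b, ∃ U : Set ℝ, IsOpen U ∧ s₀ ∈ U ∧ ∀ x y, x < y → Icc x y ⊆ U →
      Icc x y ⊆ Icc a b → g.CausalChain τ (γ x) (γ y) x y (C * ∫⁻ s in Ioc x y, w s)) :
    g.CausalChain τ (γ a) (γ b) a b (C * ∫⁻ s in Ioc a b, w s) := by
  choose! U hUo hUm hU using hloc
  -- Compactness of `[a, b]` gives a monotone sequence from `a`, eventually equal to `b`, each step
  -- of which lies in one of the `U i`.
  obtain ⟨t, ht0, htm, ⟨m, hm⟩, ht⟩ := exists_monotone_Icc_subset_open_cover_Icc hab.le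
    (c := fun i : Icc a b ↦ Subtype.val ⁻¹' U i)
    (fun i ↦ (hUo i i.2).preimage continuous_subtype_val)
    fun i _ ↦ mem_iUnion.mpr ⟨i, hUm i i.2⟩
  -- A chain needs a parameter interval of positive length, so there is none while `t n = a`; steps
  -- with `t n = t (n + 1)` are skipped.
  have key : ∀ n, (t n : ℝ) = a ∨
      g.CausalChain τ (γ a) (γ (t n)) a (t n) (C * ∫⁻ s in Ioc a (t n : ℝ), w s) := by
    intro n
    induction n with
    | zero => exact Or.inl (by rw [ht0])
    | succ n ih =>
      have hle : (t n : ℝ) ≤ t (n + 1) := htm n.le_succ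
      rcases hle.eq_or_lt with heq | hlt
      · rw [← heq]
        exact ih
      · obtain ⟨i, hi⟩ := ht n
        have hsub : Icc (t n : ℝ) (t (n + 1)) ⊆ Icc a b := Icc_subset_Icc (t n).2.1 (t (n + 1)).2.2
        have hstep := hU i i.2 (t n) (t (n + 1)) hlt
          (fun x hx ↦ hi (show (⟨x, hsub hx⟩ : Icc a b) ∈ Icc (t n) (t (n + 1)) from hx)) hsub
        right
        rcases ih with heq | hch
        · rwa [heq] at hstep
        -- Half-open intervals make the union disjoint, so the bounds add exactly.
        · have hun := Ioc_union_Ioc_eq_Ioc (t n).2.1 hle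
          rw [← hun, lintegral_union measurableSet_Ioc (Ioc_disjoint_Ioc_of_le le_rfl), mul_add]
          exact hch.trans hstep
  have hk := key m
  rw [hm m le_rfl] at hk
  exact hk.resolve_left hab.ne'

end Spacetime

end CausalChain

end NullDist

/-! ### The metric of `S` in chart coordinates -/

namespace NullDist

section ChartForm

variable {E : Type*} [NormedAddCommGroup E] [NormedSpace ℝ E]
  {S : Type*} [TopologicalSpace S] [ChartedSpace E S] [IsManifold 𝓘(ℝ, E) ∞ S]
  (h : ContMDiffRiemannianMetric 𝓘(ℝ, E) ∞ E (fun x : S ↦ TangentSpace 𝓘(ℝ, E) x))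

theorem inner_self_nonneg (y : S) (v : TangentSpace 𝓘(ℝ, E) y) : 0 ≤ h.inner y v v := by
  by_cases hv : v = 0
  · rw [hv]
    simp
  · exact (h.pos _ _ hv).le

/-- The quadratic form of the metric `h` at the point with coordinates `z.1` in the chart around
`x₀`, evaluated on the vector with coordinates `z.2`. -/
noncomputable def chartForm (x₀ : S) (z : E × E) : ℝ :=
  h.inner ((extChartAt 𝓘(ℝ, E) x₀).symm z.1)
    ((trivializationAt E (TangentSpace 𝓘(ℝ, E) : S → Type _) x₀).symm
      ((extChartAt 𝓘(ℝ, E) x₀).symm z.1) z.2)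
    ((trivializationAt E (TangentSpace 𝓘(ℝ, E) : S → Type _) x₀).symm
      ((extChartAt 𝓘(ℝ, E) x₀).symm z.1) z.2)

/-- Joint continuity in position and vector lets a strict bound on the speed at one point persist
for nearby positions and slopes. The map from coordinates to tangent vectors is smooth, since the
trivialization turns its fibre part into the second projection; the metric is then evaluated on it.
-/
theorem continuousAt_chartForm (x₀ : S) {z₀ : E × E}
    (hz₀ : z₀.1 ∈ (extChartAt 𝓘(ℝ, E) x₀).target) : ContinuousAt (chartForm h x₀) z₀ := by
  let e := trivializationAt E (TangentSpace 𝓘(ℝ, E) : S → Type _) x₀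
  let c := extChartAt 𝓘(ℝ, E) x₀
  have hopen : IsOpen c.target := isOpen_extChartAt_target x₀
  have hc : ContMDiffAt 𝓘(ℝ, E × E) 𝓘(ℝ, E) ∞ (fun z : E × E ↦ c.symm z.1) z₀ :=
    ContMDiffAt.comp z₀ ((contMDiffOn_extChartAt_symm x₀).contMDiffAt (hopen.mem_nhds hz₀))
      contDiff_fst.contMDiff.contMDiffAt
  have hbase : ∀ y ∈ c.target, c.symm y ∈ e.baseSet := by
    intro y hy
    have := c.map_target hy
    rw [extChartAt_source] at this
    simpa [e] using this
  have hX : ContMDiffAt 𝓘(ℝ, E × E) (𝓘(ℝ, E)).tangent ∞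
      (fun z : E × E ↦ (⟨c.symm z.1, e.symm (c.symm z.1) z.2⟩ : TangentBundle 𝓘(ℝ, E) S)) z₀ := by
    rw [e.contMDiffAt_iff (by rw [e.mem_source]; exact hbase _ hz₀)]
    refine ⟨hc, (contDiff_snd.contMDiff.contMDiffAt (x := z₀)).congr_of_eventuallyEq ?_⟩
    filter_upwards [(hopen.preimage continuous_fst).mem_nhds hz₀] with z hz
    rw [e.apply_mk_symm (hbase _ hz)]
  have : ContMDiffAt 𝓘(ℝ, E × E) (𝓘(ℝ, E).prod 𝓘(ℝ, ℝ)) ∞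
      (fun z : E × E ↦ TotalSpace.mk' ℝ (E := Bundle.Trivial S ℝ) (c.symm z.1)
        (chartForm h x₀ z)) z₀ := by
    apply ContMDiffAt.clm_bundle_apply₂ (F₁ := E) (F₂ := E)
      (E₁ := fun x : S ↦ TangentSpace 𝓘(ℝ, E) x) (E₂ := fun x : S ↦ TangentSpace 𝓘(ℝ, E) x)
    · exact ContMDiffAt.comp z₀ h.contMDiff.contMDiffAt hc
    · exact hX
    · exact hX
  rw [contMDiffAt_totalSpace] at this
  exact this.2.continuousAt

/-- The differential of the chart around `x₀` is the tangent trivialization around `x₀`. By the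
chain rule it sends the velocity to the derivative of the coordinate curve, and it is invertible on
the fibre. -/
theorem velocity_eq_symm_derivWithin {x₀ : S} {x : ℝ → S} {a b s : ℝ} (hab : a < b)
    (hs : s ∈ Icc a b) (hx : MDifferentiableWithinAt 𝓘(ℝ, ℝ) 𝓘(ℝ, E) x (Icc a b) s)
    (hxs : x s ∈ (extChartAt 𝓘(ℝ, E) x₀).source) :
    velocity 𝓘(ℝ, E) x a b s =
      (trivializationAt E (TangentSpace 𝓘(ℝ, E) : S → Type _) x₀).symm (x s)
        (derivWithin (extChartAt 𝓘(ℝ, E) x₀ ∘ x) (Icc a b) s) := by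
  let e := trivializationAt E (TangentSpace 𝓘(ℝ, E) : S → Type _) x₀
  have hxs' : x s ∈ (chartAt E x₀).source := by rwa [extChartAt_source] at hxs
  have hbase : x s ∈ e.baseSet := by simpa [e] using hxs'
  have hu : UniqueMDiffWithinAt 𝓘(ℝ, ℝ) (Icc a b) s :=
    (uniqueDiffOn_Icc hab s hs).uniqueMDiffWithinAt
  have h1 := mfderiv_comp_mfderivWithin s (mdifferentiableAt_extChartAt (I := 𝓘(ℝ, E)) hxs') hx hu
  rw [mfderivWithin_eq_fderivWithin, ← TangentBundle.continuousLinearMapAt_trivializationAt hxs']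
    at h1
  have h2 : derivWithin (extChartAt 𝓘(ℝ, E) x₀ ∘ x) (Icc a b) s =
      e.continuousLinearMapAt ℝ (x s) (velocity 𝓘(ℝ, E) x a b s) := by
    rw [← fderivWithin_derivWithin]
    exact congrArg (fun L : ℝ →L[ℝ] E ↦ L 1) h1
  rw [h2, ← e.symmL_apply (R := ℝ) hbase, e.symmL_continuousLinearMapAt hbase]

theorem inner_velocity_eq_chartForm {x₀ : S} {x : ℝ → S} {a b s : ℝ} (hab : a < b)
    (hs : s ∈ Icc a b) (hx : MDifferentiableWithinAt 𝓘(ℝ, ℝ) 𝓘(ℝ, E) x (Icc a b) s)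
    (hxs : x s ∈ (extChartAt 𝓘(ℝ, E) x₀).source) :
    h.inner (x s) (velocity 𝓘(ℝ, E) x a b s) (velocity 𝓘(ℝ, E) x a b s) =
      chartForm h x₀ (extChartAt 𝓘(ℝ, E) x₀ (x s),
        derivWithin (extChartAt 𝓘(ℝ, E) x₀ ∘ x) (Icc a b) s) := by
  rw [velocity_eq_symm_derivWithin hab hs hx hxs]
  simp only [chartForm]
  rw [(extChartAt 𝓘(ℝ, E) x₀).left_inv hxs]

end ChartForm

end NullDist

/-! ### Causal curves given by chart coordinates -/

namespace NullDist

section CausalSegment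

variable {E : Type*} [NormedAddCommGroup E] [NormedSpace ℝ E]
  {S : Type*} [TopologicalSpace S] [ChartedSpace E S] [IsManifold 𝓘(ℝ, E) ∞ S]
  {J : TopologicalSpace.Opens ℝ}

theorem mem_chartAt_target_opens (t : J) {y : ℝ} (hy : y ∈ J) : y ∈ (chartAt ℝ t).target :=
  (chartAt ℝ t).map_source (x := (⟨y, hy⟩ : J)) (by
    rw [TopologicalSpace.Opens.chartAt_eq, OpenPartialHomeomorph.subtypeRestr_source]
    exact mem_preimage.mpr (by rw [chartAt_self_eq]; trivial))

theorem val_chartAt_symm_opens (t : J) {y : ℝ} (hy : y ∈ J) :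
    ((chartAt ℝ t).symm y : ℝ) = y :=
  (chartAt ℝ t).right_inv (mem_chartAt_target_opens t hy)

theorem dt_velocity {γ : ℝ → J × S} {a b s : ℝ} (hab : a < b) (hs : s ∈ Icc a b)
    (hγ : MDifferentiableWithinAt 𝓘(ℝ, ℝ) (𝓘(ℝ, ℝ).prod 𝓘(ℝ, E)) γ (Icc a b) s) :
    dt (γ s) (velocity (𝓘(ℝ, ℝ).prod 𝓘(ℝ, E)) γ a b s) =
      derivWithin (fun s ↦ ((γ s).1 : ℝ)) (Icc a b) s := by
  have h1 := ((hasMFDerivAt_time (E := E) (γ s)).comp_hasMFDerivWithinAt s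
    hγ.hasMFDerivWithinAt).mfderivWithin (uniqueDiffOn_Icc hab s hs).uniqueMDiffWithinAt
  rw [mfderivWithin_eq_fderivWithin] at h1
  rw [← fderivWithin_derivWithin]
  exact (congrArg (fun L : ℝ →L[ℝ] ℝ ↦ L 1) h1).symm

theorem dx_velocity {γ : ℝ → J × S} {a b s : ℝ} (hab : a < b) (hs : s ∈ Icc a b)
    (hγ : MDifferentiableWithinAt 𝓘(ℝ, ℝ) (𝓘(ℝ, ℝ).prod 𝓘(ℝ, E)) γ (Icc a b) s) :
    dx (γ s) (velocity (𝓘(ℝ, ℝ).prod 𝓘(ℝ, E)) γ a b s) =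
      velocity 𝓘(ℝ, E) (fun s ↦ (γ s).2) a b s := by
  have h1 := ((hasMFDerivAt_snd (I := 𝓘(ℝ, ℝ)) (I' := 𝓘(ℝ, E)) (γ s)).comp_hasMFDerivWithinAt s
    hγ.hasMFDerivWithinAt).mfderivWithin (uniqueDiffOn_Icc hab s hs).uniqueMDiffWithinAt
  exact (congrArg (fun L : ℝ →L[ℝ] E ↦ L 1) h1).symm

/-- The curve in `J × S` with coordinates `τ` and `u` in the charts around `t` and `x`. -/
noncomputable def chartCurve (t : J) (x : S) (τ : ℝ → ℝ) (u : ℝ → E) (s : ℝ) : J × S :=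
  ((chartAt ℝ t).symm (τ s), (extChartAt 𝓘(ℝ, E) x).symm (u s))

variable {t : J} {x : S} {τ : ℝ → ℝ} {u : ℝ → E} {a b : ℝ}

theorem contMDiffOn_chartCurve {A : Set ℝ} (hτ : ContDiffOn ℝ ∞ τ A) (hu : ContDiffOn ℝ ∞ u A)
    (hτJ : MapsTo τ A J) (huc : MapsTo u A (extChartAt 𝓘(ℝ, E) x).target) :
    ContMDiffOn 𝓘(ℝ, ℝ) (𝓘(ℝ, ℝ).prod 𝓘(ℝ, E)) ∞ (chartCurve t x τ u) A := by
  refine ContMDiffOn.prodMk ?_ ?_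
  · exact (contMDiffOn_chart_symm (I := 𝓘(ℝ, ℝ)) (x := t)).comp hτ.contMDiffOn
      fun s hs ↦ mem_chartAt_target_opens t (hτJ hs)
  · exact (contMDiffOn_extChartAt_symm x).comp hu.contMDiffOn huc

theorem dt_velocity_chartCurve (hab : a < b) (hτ : ContDiffOn ℝ ∞ τ (Icc a b))
    (hu : ContDiffOn ℝ ∞ u (Icc a b)) (hτJ : MapsTo τ (Icc a b) J)
    (huc : MapsTo u (Icc a b) (extChartAt 𝓘(ℝ, E) x).target) {s : ℝ} (hs : s ∈ Icc a b) :
    dt (chartCurve t x τ u s) (velocity (𝓘(ℝ, ℝ).prod 𝓘(ℝ, E)) (chartCurve t x τ u) a b s) =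
      derivWithin τ (Icc a b) s := by
  rw [dt_velocity hab hs ((contMDiffOn_chartCurve hτ hu hτJ huc).mdifferentiableOn (by simp) s hs)]
  exact derivWithin_congr (fun r hr ↦ val_chartAt_symm_opens t (hτJ hr))
    (val_chartAt_symm_opens t (hτJ hs))

variable (h : ContMDiffRiemannianMetric 𝓘(ℝ, E) ∞ E (fun x : S ↦ TangentSpace 𝓘(ℝ, E) x))

theorem inner_dx_velocity_chartCurve (hab : a < b) (hτ : ContDiffOn ℝ ∞ τ (Icc a b))
    (hu : ContDiffOn ℝ ∞ u (Icc a b)) (hτJ : MapsTo τ (Icc a b) J)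
    (huc : MapsTo u (Icc a b) (extChartAt 𝓘(ℝ, E) x).target) {s : ℝ} (hs : s ∈ Icc a b) :
    h.inner (chartCurve t x τ u s).2
      (dx (chartCurve t x τ u s)
        (velocity (𝓘(ℝ, ℝ).prod 𝓘(ℝ, E)) (chartCurve t x τ u) a b s))
      (dx (chartCurve t x τ u s)
        (velocity (𝓘(ℝ, ℝ).prod 𝓘(ℝ, E)) (chartCurve t x τ u) a b s)) =
      chartForm h x (u s, derivWithin u (Icc a b) s) := by
  have hd := (contMDiffOn_chartCurve (t := t) hτ hu hτJ huc).mdifferentiableOn (by simp) s hs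
  have hd2 : MDifferentiableWithinAt 𝓘(ℝ, ℝ) 𝓘(ℝ, E) (fun s ↦ (chartCurve t x τ u s).2)
      (Icc a b) s := mdifferentiableAt_snd.comp_mdifferentiableWithinAt s hd
  rw [dx_velocity hab hs hd]
  have hinv : ∀ r ∈ Icc a b, extChartAt 𝓘(ℝ, E) x (chartCurve t x τ u r).2 = u r :=
    fun r hr ↦ (extChartAt 𝓘(ℝ, E) x).right_inv (huc hr)
  refine (inner_velocity_eq_chartForm h hab hs hd2
    ((extChartAt 𝓘(ℝ, E) x).map_target (huc hs))).trans ?_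
  have hdw : derivWithin (extChartAt 𝓘(ℝ, E) x ∘ fun s ↦ (chartCurve t x τ u s).2) (Icc a b) s =
      derivWithin u (Icc a b) s := derivWithin_congr (fun r hr ↦ hinv r hr) (hinv s hs)
  rw [hinv s hs, hdw]

variable [FiniteDimensional ℝ E] [ConnectedSpace S]
  (hJ : (J : Set ℝ).OrdConnected) (hne : (J : Set ℝ).Nonempty)
  (f : ℝ → ℝ) (hf : ContDiffOn ℝ ∞ f J) (hpos : ∀ t ∈ J, 0 < f t)

theorem grw_val_velocity_chartCurve (hab : a < b) (hτ : ContDiffOn ℝ ∞ τ (Icc a b))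
    (hu : ContDiffOn ℝ ∞ u (Icc a b)) (hτJ : MapsTo τ (Icc a b) J)
    (huc : MapsTo u (Icc a b) (extChartAt 𝓘(ℝ, E) x).target) {s : ℝ} (hs : s ∈ Icc a b) :
    (grw J hJ hne f hf hpos h).val _
      (velocity (𝓘(ℝ, ℝ).prod 𝓘(ℝ, E)) (chartCurve t x τ u) a b s)
      (velocity (𝓘(ℝ, ℝ).prod 𝓘(ℝ, E)) (chartCurve t x τ u) a b s) =
      -(derivWithin τ (Icc a b) s) ^ 2 +
        f (τ s) ^ 2 * chartForm h x (u s, derivWithin u (Icc a b) s) := by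
  rw [grw_val_apply, dt_velocity_chartCurve hab hτ hu hτJ huc hs,
    inner_dx_velocity_chartCurve h hab hτ hu hτJ huc hs, sq,
    show ((chartCurve t x τ u s).1 : ℝ) = τ s from val_chartAt_symm_opens t (hτJ hs)]
  ring

/-- The hypothesis `hle` is the inequality `g(X, X) ≤ 0` in coordinates. That `X` is non-zero and
future-directed both follow from `τ' > 0`, since `dt(X) = τ'` and `g(X, ∂_t) = -dt(X)`. -/
theorem isFutureCausalCurve_chartCurve (hab : a < b) (hτ : ContDiffOn ℝ ∞ τ (Icc a b))
    (hu : ContDiffOn ℝ ∞ u (Icc a b)) (hτJ : MapsTo τ (Icc a b) J)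
    (huc : MapsTo u (Icc a b) (extChartAt 𝓘(ℝ, E) x).target)
    (hτ' : ∀ s ∈ Icc a b, 0 < derivWithin τ (Icc a b) s)
    (hle : ∀ s ∈ Icc a b, f (τ s) ^ 2 * chartForm h x (u s, derivWithin u (Icc a b) s) ≤
      (derivWithin τ (Icc a b) s) ^ 2) :
    (grw J hJ hne f hf hpos h).IsFutureCausalCurve (chartCurve t x τ u) a b := by
  refine ⟨contMDiffOn_chartCurve hτ hu hτJ huc, fun s hs ↦ ?_⟩
  have hdt := dt_velocity_chartCurve (t := t) hab hτ hu hτJ huc hs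
  refine ⟨⟨fun h0 ↦ ?_, ?_⟩, ?_⟩
  · rw [h0, map_zero] at hdt
    exact (hτ' s hs).ne hdt
  · rw [grw_val_velocity_chartCurve h hJ hne f hf hpos hab hτ hu hτJ huc hs]
    linarith [hle s hs]
  · refine (grw_val_partialT J hJ hne f hf hpos h _ _).trans_lt ?_
    rw [hdt]
    linarith [hτ' s hs]

theorem isPastCausalCurve_chartCurve (hab : a < b) (hτ : ContDiffOn ℝ ∞ τ (Icc a b))
    (hu : ContDiffOn ℝ ∞ u (Icc a b)) (hτJ : MapsTo τ (Icc a b) J)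
    (huc : MapsTo u (Icc a b) (extChartAt 𝓘(ℝ, E) x).target)
    (hτ' : ∀ s ∈ Icc a b, derivWithin τ (Icc a b) s < 0)
    (hle : ∀ s ∈ Icc a b, f (τ s) ^ 2 * chartForm h x (u s, derivWithin u (Icc a b) s) ≤
      (derivWithin τ (Icc a b) s) ^ 2) :
    (grw J hJ hne f hf hpos h).IsPastCausalCurve (chartCurve t x τ u) a b := by
  refine ⟨contMDiffOn_chartCurve hτ hu hτJ huc, fun s hs ↦ ?_⟩
  have hdt := dt_velocity_chartCurve (t := t) hab hτ hu hτJ huc hs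
  refine ⟨⟨fun h0 ↦ ?_, ?_⟩, ?_⟩
  · rw [h0, map_zero] at hdt
    exact (hτ' s hs).ne' hdt
  · rw [grw_val_velocity_chartCurve h hJ hne f hf hpos hab hτ hu hτJ huc hs]
    linarith [hle s hs]
  · refine LT.lt.trans_eq ?_ (grw_val_partialT J hJ hne f hf hpos h _ _).symm
    rw [hdt]
    linarith [hτ' s hs]

end CausalSegment

end NullDist

/-! ### Zigzags over chart segments -/

namespace NullDist

section LevelSets

variable {E : Type*} [NormedAddCommGroup E] [NormedSpace ℝ E]
  {S : Type*} [TopologicalSpace S] [ChartedSpace E S] [IsManifold 𝓘(ℝ, E) ∞ S]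
  {J : TopologicalSpace.Opens ℝ}
  (h : ContMDiffRiemannianMetric 𝓘(ℝ, E) ∞ E (fun x : S ↦ TangentSpace 𝓘(ℝ, E) x))
  [FiniteDimensional ℝ E] [ConnectedSpace S]
  (hJ : (J : Set ℝ).OrdConnected) (hne : (J : Set ℝ).Nonempty)
  (f : ℝ → ℝ) (hf : ContDiffOn ℝ ∞ f J) (hpos : ∀ t ∈ J, 0 < f t)

/-- The zigzag over a chart segment: first future-directed with slope `k`, then past-directed with
slope `-k`. -/
theorem causalChain_zigzag (φ : ℝ → ℝ) (t : J) (x : S) {k a b : ℝ} (hk : 0 < k) (hab : a < b)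
    (y v : E)
    (hy : ∀ s ∈ Icc a b, y + (s - a) • v ∈ (extChartAt 𝓘(ℝ, E) x).target)
    (ht : ∀ r ∈ Icc 0 (k * ((b - a) / 2)), (t : ℝ) + r ∈ J)
    (hle : ∀ r ∈ Icc 0 (k * ((b - a) / 2)), ∀ s ∈ Icc a b,
      f (t + r) ^ 2 * chartForm h x (y + (s - a) • v, v) ≤ k ^ 2) :
    (grw J hJ hne f hf hpos h).CausalChain (fun p : J × S ↦ φ p.1)
      (t, (extChartAt 𝓘(ℝ, E) x).symm y)
      (t, (extChartAt 𝓘(ℝ, E) x).symm (y + (b - a) • v)) a b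
      (2 * ENNReal.ofReal |φ (t + k * ((b - a) / 2)) - φ t|) := by
  -- The legs meet over the midpoint, at height `k (b - a) / 2` above `t`, and the second one is
  -- back at `t` when `s = b`.
  let m := (a + b) / 2
  let τ₁ : ℝ → ℝ := fun s ↦ t + k * (s - a)
  let τ₂ : ℝ → ℝ := fun s ↦ t + k * (b - s)
  let u : ℝ → E := fun s ↦ y + (s - a) • v
  have ham : a < m := by simp only [m]; linarith
  have hmb : m < b := by simp only [m]; linarith
  have hu : ContDiff ℝ ∞ u := by fun_prop
  have hτ₁ : ContDiff ℝ ∞ τ₁ := by fun_prop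
  have hτ₂ : ContDiff ℝ ∞ τ₂ := by fun_prop
  have hu' : ∀ s, HasDerivAt u v s := fun s ↦ (one_smul ℝ v) ▸
    (((hasDerivAt_id s).sub_const a).smul_const v).const_add y
  have hτ₁' : ∀ s, HasDerivAt τ₁ k s := fun s ↦ (mul_one k) ▸
    (((hasDerivAt_id s).sub_const a).const_mul k).const_add (t : ℝ)
  have hτ₂' : ∀ s, HasDerivAt τ₂ (-k) s := fun s ↦ (mul_neg_one k) ▸
    (((hasDerivAt_id s).const_sub b).const_mul k).const_add (t : ℝ)
  have hr₁ : ∀ s ∈ Icc a m, k * (s - a) ∈ Icc 0 (k * ((b - a) / 2)) := fun s hs ↦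
    ⟨mul_nonneg hk.le (sub_nonneg.mpr hs.1), mul_le_mul_of_nonneg_left
      (by have := hs.2; simp only [m] at this; linarith) hk.le⟩
  have hr₂ : ∀ s ∈ Icc m b, k * (b - s) ∈ Icc 0 (k * ((b - a) / 2)) := fun s hs ↦
    ⟨mul_nonneg hk.le (sub_nonneg.mpr hs.2), mul_le_mul_of_nonneg_left
      (by have := hs.1; simp only [m] at this; linarith) hk.le⟩
  have hs₁ : Icc a m ⊆ Icc a b := Icc_subset_Icc_right hmb.le
  have hs₂ : Icc m b ⊆ Icc a b := Icc_subset_Icc_left ham.le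
  have hdu : ∀ {c d s}, c < d → s ∈ Icc c d → derivWithin u (Icc c d) s = v :=
    fun hcd hs ↦ (hu' _).hasDerivWithinAt.derivWithin (uniqueDiffOn_Icc hcd _ hs)
  have hd₁ : ∀ {s}, s ∈ Icc a m → derivWithin τ₁ (Icc a m) s = k :=
    fun hs ↦ (hτ₁' _).hasDerivWithinAt.derivWithin (uniqueDiffOn_Icc ham _ hs)
  have hd₂ : ∀ {s}, s ∈ Icc m b → derivWithin τ₂ (Icc m b) s = -k :=
    fun hs ↦ (hτ₂' _).hasDerivWithinAt.derivWithin (uniqueDiffOn_Icc hmb _ hs)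
  have H₁ := isFutureCausalCurve_chartCurve (t := t) (x := x) h hJ hne f hf hpos ham
    hτ₁.contDiffOn hu.contDiffOn (fun s hs ↦ ht _ (hr₁ s hs)) (fun s hs ↦ hy s (hs₁ hs))
    (fun s hs ↦ by rw [hd₁ hs]; exact hk)
    (fun s hs ↦ by rw [hd₁ hs, hdu ham hs]; exact hle _ (hr₁ s hs) s (hs₁ hs))
  have H₂ := isPastCausalCurve_chartCurve (t := t) (x := x) h hJ hne f hf hpos hmb
    hτ₂.contDiffOn hu.contDiffOn (fun s hs ↦ ht _ (hr₂ s hs)) (fun s hs ↦ hy s (hs₂ hs))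
    (fun s hs ↦ by rw [hd₂ hs]; linarith)
    (fun s hs ↦ by rw [hd₂ hs, hdu hmb hs, neg_sq]; exact hle _ (hr₂ s hs) s (hs₂ hs))
  have C₁ := Spacetime.CausalChain.of_causalCurve (τ := fun p : J × S ↦ φ p.1) ham (Or.inl H₁)
  have C₂ := Spacetime.CausalChain.of_causalCurve (τ := fun p : J × S ↦ φ p.1) hmb (Or.inr H₂)
  have hm : τ₁ m = τ₂ m := by simp only [τ₁, τ₂, m]; ring
  have hm' : τ₂ m = t + k * ((b - a) / 2) := by simp only [τ₂, m]; ring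
  have hmJ : τ₂ m ∈ J := by
    rw [hm']
    exact ht _ ⟨by have := sub_pos.mpr hab; positivity, le_rfl⟩
  have htt : (chartAt ℝ t).symm (t : ℝ) = t := Subtype.ext (val_chartAt_symm_opens t t.2)
  have ha : chartCurve t x τ₁ u a = (t, (extChartAt 𝓘(ℝ, E) x).symm y) := by
    simp [chartCurve, τ₁, u, htt]
  have hb : chartCurve t x τ₂ u b = (t, (extChartAt 𝓘(ℝ, E) x).symm (y + (b - a) • v)) := by
    simp [chartCurve, τ₂, u, htt]
  have hmid : chartCurve t x τ₁ u m = chartCurve t x τ₂ u m := by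
    simp only [chartCurve, hm]
  have hmt : ((chartCurve t x τ₂ u m).1 : ℝ) = t + k * ((b - a) / 2) :=
    (val_chartAt_symm_opens t hmJ).trans hm'
  rw [ha, hmid] at C₁
  rw [hb] at C₂
  refine (C₁.trans C₂).mono (le_of_eq ?_)
  rw [two_mul]
  simp only [hmt]
  rw [abs_sub_comm (φ t)]

end LevelSets

end NullDist

/-! ### Short zigzags along a `C¹` curve -/

namespace NullDist

section Slopes

variable {E : Type*} [NormedAddCommGroup E] [NormedSpace ℝ E]

/-- Near a point where its derivative within a convex set is continuous, a function has chord
slopes close to that derivative. -/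
theorem norm_slope_sub_le_of_derivWithin {w : ℝ → E} {A : Set ℝ} {B : Set ℝ} {v : E} {ε : ℝ}
    (hB : Convex ℝ B) (hBA : B ⊆ A)
    (hw : ∀ s ∈ B, DifferentiableWithinAt ℝ w A s)
    (hv : ∀ s ∈ B, ‖derivWithin w A s - v‖ ≤ ε) {a b : ℝ} (ha : a ∈ B) (hb : b ∈ B)
    (hab : a < b) : ‖(b - a)⁻¹ • (w b - w a) - v‖ ≤ ε := by
  -- Mean value inequality for `w s - s • v`, whose derivative has norm at most `ε`.
  have h1 := hB.norm_image_sub_le_of_norm_hasDerivWithin_le (f := fun s ↦ w s - s • v)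
    (f' := fun s ↦ derivWithin w A s - v) (C := ε) (fun s hs ↦ ?_) hv ha hb
  · have hba : 0 < b - a := sub_pos.mpr hab
    have h2 : (b - a)⁻¹ • (w b - w a) - v = (b - a)⁻¹ • (w b - b • v - (w a - a • v)) := by
      rw [show w b - b • v - (w a - a • v) = (w b - w a) - (b - a) • v by rw [sub_smul]; abel,
        smul_sub _ _ ((b - a) • v), inv_smul_smul₀ hba.ne']
    rw [h2, norm_smul, norm_inv, Real.norm_of_nonneg hba.le, inv_mul_le_iff₀ hba, mul_comm]
    rwa [Real.norm_of_nonneg hba.le] at h1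
  · have := ((hw s hs).hasDerivWithinAt.mono hBA).sub
      ((hasDerivWithinAt_id s B).smul_const v)
    rw [one_smul] at this
    exact this

/-- The difference quotient tends to `φ'(t) < P`. This turns the height of a short zigzag into a
bound on its null length. -/
theorem eventually_abs_sub_le_of_deriv_lt {φ : ℝ → ℝ} {t P : ℝ} (hφ : DifferentiableAt ℝ φ t)
    (hpos : 0 < deriv φ t) (hP : deriv φ t < P) :
    ∀ᶠ r in 𝓝 (0 : ℝ), |φ (t + r) - φ t| ≤ P * |r| := by
  have h1 := hφ.hasDerivAt.isLittleO
  have h2 := (h1.def (sub_pos.mpr hP))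
  have h3 : Filter.Tendsto (fun r : ℝ ↦ t + r) (𝓝 0) (𝓝 t) := by
    simpa using (tendsto_const_nhds (x := t)).add (Filter.tendsto_id (x := 𝓝 (0 : ℝ)))
  filter_upwards [h3.eventually h2] with r hr
  simp only [add_sub_cancel_left, smul_eq_mul, Real.norm_eq_abs] at hr
  have h4 : |φ (t + r) - φ t| ≤ |φ (t + r) - φ t - r * deriv φ t| + |r * deriv φ t| := by
    simpa using abs_add_le (φ (t + r) - φ t - r * deriv φ t) (r * deriv φ t)
  rw [abs_mul, abs_of_pos hpos] at h4
  linarith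

end Slopes

section LevelSets

variable {E : Type*} [NormedAddCommGroup E] [NormedSpace ℝ E]
  {S : Type*} [TopologicalSpace S] [ChartedSpace E S] [IsManifold 𝓘(ℝ, E) ∞ S]
  {J : TopologicalSpace.Opens ℝ}
  (h : ContMDiffRiemannianMetric 𝓘(ℝ, E) ∞ E (fun x : S ↦ TangentSpace 𝓘(ℝ, E) x))

/-- The facts about a `C¹` curve near a parameter `s₀` that are read off in the chart around its
value there. -/
theorem eventually_chart_of_contMDiffOn {x : ℝ → S} {A B s₀ : ℝ} (hAB : A < B)
    (hs₀ : s₀ ∈ Icc A B) (hx : ContMDiffOn 𝓘(ℝ, ℝ) 𝓘(ℝ, E) 1 x (Icc A B)) :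
    (∀ᶠ s in 𝓝[Icc A B] s₀, x s ∈ (extChartAt 𝓘(ℝ, E) (x s₀)).source ∧
      DifferentiableWithinAt ℝ (extChartAt 𝓘(ℝ, E) (x s₀) ∘ x) (Icc A B) s) ∧
    ContinuousWithinAt (extChartAt 𝓘(ℝ, E) (x s₀) ∘ x) (Icc A B) s₀ ∧
    ContinuousWithinAt (derivWithin (extChartAt 𝓘(ℝ, E) (x s₀) ∘ x) (Icc A B)) (Icc A B) s₀ := by
  let c := extChartAt 𝓘(ℝ, E) (x s₀)
  have hsrc : ∀ᶠ s in 𝓝[Icc A B] s₀, x s ∈ c.source :=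
    (hx.continuousOn s₀ hs₀).eventually (extChartAt_source_mem_nhds (x s₀))
  have hcd : ∀ s ∈ Icc A B, x s ∈ c.source → ContDiffWithinAt ℝ 1 (c ∘ x) (Icc A B) s := by
    intro s hs hxs
    refine ContMDiffWithinAt.contDiffWithinAt ?_
    refine ContMDiffAt.comp_contMDiffWithinAt s ?_ (hx s hs)
    exact contMDiffAt_extChartAt' (by rwa [extChartAt_source] at hxs)
  have h0 := hcd s₀ hs₀ (mem_extChartAt_source _)
  refine ⟨?_, h0.continuousWithinAt, ?_⟩
  · filter_upwards [hsrc, self_mem_nhdsWithin] with s h1 h2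
    exact ⟨h1, (hcd s h2 h1).differentiableWithinAt (by simp)⟩
  · have h1 := (h0.fderivWithin_right (m := 0) (uniqueDiffOn_Icc hAB) (by simp)
      hs₀).continuousWithinAt
    have h2 := h1.clm_apply (continuousWithinAt_const (b := (1 : ℝ)))
    exact h2.congr (fun s _ ↦ fderivWithin_derivWithin.symm) fderivWithin_derivWithin.symm

/-- The speed of a `C¹` curve is continuous. -/
theorem continuousOn_inner_velocity {x : ℝ → S} {A B : ℝ} (hAB : A < B)
    (hx : ContMDiffOn 𝓘(ℝ, ℝ) 𝓘(ℝ, E) 1 x (Icc A B)) :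
    ContinuousOn (fun s ↦ h.inner (x s) (velocity 𝓘(ℝ, E) x A B s) (velocity 𝓘(ℝ, E) x A B s))
      (Icc A B) := by
  intro s₀ hs₀
  obtain ⟨h1, h2, h3⟩ := eventually_chart_of_contMDiffOn hAB hs₀ hx
  have hG := (continuousAt_chartForm h (x s₀)
    (z₀ := (extChartAt 𝓘(ℝ, E) (x s₀) (x s₀),
      derivWithin (extChartAt 𝓘(ℝ, E) (x s₀) ∘ x) (Icc A B) s₀))
    (mem_extChartAt_target _)).comp_continuousWithinAt_of_eq (h2.prodMk h3) rfl
  have hd := hx.mdifferentiableOn (by simp)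
  refine hG.congr_of_eventuallyEq ?_
    (inner_velocity_eq_chartForm h hAB hs₀ (hd s₀ hs₀) (mem_extChartAt_source _))
  filter_upwards [h1, self_mem_nhdsWithin] with s h4 h5
  exact inner_velocity_eq_chartForm h hAB h5 (hd s h5) h4.1

variable [FiniteDimensional ℝ E] [ConnectedSpace S]
  (hJ : (J : Set ℝ).OrdConnected) (hne : (J : Set ℝ).Nonempty)
  (f : ℝ → ℝ) (hf : ContDiffOn ℝ ∞ f J) (hpos : ∀ t ∈ J, 0 < f t)

/-- The heart of the estimate. With `k` slightly above the speed at `s₀`, causality of the zigzag is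
a strict inequality at height `0`, position `w s₀` and slope `v₀`. It therefore survives on a
neighbourhood, which contains all the data of a zigzag over a short enough interval near `s₀`. -/
theorem causalChain_local {φ : ℝ → ℝ} (hφ : ContDiffOn ℝ ∞ φ J)
    (hφ' : ∀ t ∈ J, 0 < deriv φ t) (t : J) {P δ : ℝ} (hP : deriv φ t < P) (hδ : 0 < δ)
    {x : ℝ → S} {A B s₀ : ℝ} (hAB : A < B) (hs₀ : s₀ ∈ Icc A B)
    (hx : ContMDiffOn 𝓘(ℝ, ℝ) 𝓘(ℝ, E) 1 x (Icc A B)) :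
    ∃ U : Set ℝ, IsOpen U ∧ s₀ ∈ U ∧ ∀ a b, a < b → Icc a b ⊆ U → Icc a b ⊆ Icc A B →
      (grw J hJ hne f hf hpos h).CausalChain (fun p : J × S ↦ φ p.1) (t, x a) (t, x b) a b
        (ENNReal.ofReal P * ∫⁻ s in Ioc a b,
          (ENNReal.ofReal (f t * √(h.inner (x s) (velocity 𝓘(ℝ, E) x A B s)
            (velocity 𝓘(ℝ, E) x A B s))) + ENNReal.ofReal δ)) := by
  let c := extChartAt 𝓘(ℝ, E) (x s₀)
  let w := c ∘ x
  let v₀ := derivWithin w (Icc A B) s₀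
  let W : ℝ → ℝ := fun s ↦ f t * √(h.inner (x s) (velocity 𝓘(ℝ, E) x A B s)
            (velocity 𝓘(ℝ, E) x A B s))
  -- Half of `δ` gives strictness in `hWsq`; the other half absorbs the variation of `W`, so that `k
  -- ≤ W s + δ` near `s₀`.
  let k := W s₀ + δ / 2
  have hft : 0 < f t := hpos t t.2
  have hW0 : 0 ≤ W s₀ := by positivity
  have hk : 0 < k := by positivity
  have hPpos : 0 < P := (hφ' t t.2).trans hP
  obtain ⟨h1, h2, h3⟩ := eventually_chart_of_contMDiffOn hAB hs₀ hx
  have hval : h.inner (x s₀) (velocity 𝓘(ℝ, E) x A B s₀) (velocity 𝓘(ℝ, E) x A B s₀) =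
      chartForm h (x s₀) (w s₀, v₀) := inner_velocity_eq_chartForm h hAB hs₀
    (hx.mdifferentiableOn (by simp) s₀ hs₀) (mem_extChartAt_source _)
  have hnn : 0 ≤ chartForm h (x s₀) (w s₀, v₀) := by
    rw [← hval]
    exact inner_self_nonneg h _ _
  have hWsq : f (t + 0) ^ 2 * chartForm h (x s₀) (w s₀, v₀) < k ^ 2 := by
    have : f (t + 0) ^ 2 * chartForm h (x s₀) (w s₀, v₀) = W s₀ ^ 2 := by
      simp only [W]
      rw [mul_pow, hval, Real.sq_sqrt hnn, add_zero]
    rw [this]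
    exact pow_lt_pow_left₀ (by simp only [k]; linarith) hW0 two_ne_zero
  have hfc : ContinuousAt (fun r ↦ f (t + r)) 0 := by
    refine ContinuousAt.comp (f := fun r : ℝ ↦ (t : ℝ) + r) ?_ (by fun_prop)
    rw [add_zero]
    exact hf.continuousOn.continuousAt (J.2.mem_nhds t.2)
  have hG : ContinuousAt (fun z : ℝ × E × E ↦ f (t + z.1) ^ 2 * chartForm h (x s₀) z.2)
      (0, w s₀, v₀) :=
    ((ContinuousAt.comp (f := Prod.fst) (x := ((0 : ℝ), w s₀, v₀)) hfc continuousAt_fst).pow 2).mul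
      (ContinuousAt.comp (f := Prod.snd) (x := ((0 : ℝ), w s₀, v₀))
        (continuousAt_chartForm h (x s₀) (mem_extChartAt_target _)) continuousAt_snd)
  have hJev : ∀ᶠ z : ℝ × E × E in 𝓝 (0, w s₀, v₀), (t : ℝ) + z.1 ∈ J := by
    have hc : ContinuousAt (fun z : ℝ × E × E ↦ (t : ℝ) + z.1) (0, w s₀, v₀) := by fun_prop
    exact hc.eventually (J.2.mem_nhds (by simp))
  have hcev : ∀ᶠ z : ℝ × E × E in 𝓝 (0, w s₀, v₀), z.2.1 ∈ c.target := by
    have hc : ContinuousAt (fun z : ℝ × E × E ↦ z.2.1) (0, w s₀, v₀) := by fun_prop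
    exact hc.eventually (extChartAt_target_mem_nhds (I := 𝓘(ℝ, E)) (x s₀))
  obtain ⟨ε, hε, hball⟩ := Metric.eventually_nhds_iff_ball.mp
    ((hG.eventually (gt_mem_nhds hWsq)).and (hJev.and hcev))
  obtain ⟨η, hη, hφball⟩ := Metric.eventually_nhds_iff_ball.mp (eventually_abs_sub_le_of_deriv_lt
    (((hφ t t.2).contDiffAt (J.2.mem_nhds t.2)).differentiableAt (by simp)) (hφ' t t.2) hP)
  have hWc : ContinuousWithinAt W (Icc A B) s₀ :=
    continuousWithinAt_const.mul (continuousOn_inner_velocity h hAB hx s₀ hs₀).sqrt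
  -- The radius is `ε / 2` for the derivative because the chord slope inherits only a non-strict
  -- bound, while `hv` needs a strict one.
  have hloc := h1.and ((h2.eventually (Metric.ball_mem_nhds (w s₀) hε)).and
    ((h3.eventually (Metric.ball_mem_nhds v₀ (half_pos hε))).and
      (hWc.eventually (lt_mem_nhds (show W s₀ - δ / 2 < W s₀ by linarith)))))
  obtain ⟨ρ, hρ, hρball⟩ := Metric.mem_nhdsWithin_iff.mp hloc
  -- Beyond staying in the `ρ`-ball, this keeps the peak height `k (b - a) / 2` below both `ε` and
  -- `η`, since `(b - a) / 2 < R`.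
  let R := min ρ (min ε η / k)
  have hR : 0 < R := lt_min hρ (div_pos (lt_min hε hη) hk)
  refine ⟨Metric.ball s₀ R, Metric.isOpen_ball, Metric.mem_ball_self hR, fun a b hab hU hI ↦ ?_⟩
  have hB : ∀ s ∈ Icc a b, s ∈ Metric.ball s₀ ρ ∩ Icc A B :=
    fun s hs ↦ ⟨Metric.ball_subset_ball (min_le_left _ _) (hU hs), hI hs⟩
  have hba : 0 < b - a := sub_pos.mpr hab
  have haI : a ∈ Icc a b := left_mem_Icc.mpr hab.le
  have hbI : b ∈ Icc a b := right_mem_Icc.mpr hab.le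
  have hkR : k * ((b - a) / 2) < min ε η := by
    have h4 := abs_lt.mp (Metric.mem_ball.mp (hU haI))
    have h5 := abs_lt.mp (Metric.mem_ball.mp (hU hbI))
    have h6 : (b - a) / 2 < min ε η / k := by
      have : R ≤ min ε η / k := min_le_right _ _
      linarith [h4.1, h5.2]
    rwa [lt_div_iff₀ hk, mul_comm] at h6
  -- The chord slope: the segment from `w a` with this velocity ends exactly at `w b`.
  let v := (b - a)⁻¹ • (w b - w a)
  have hv : ‖v - v₀‖ < ε := by
    refine (norm_slope_sub_le_of_derivWithin (convex_Icc a b) hI (fun s hs ↦ (hρball (hB s hs)).1.2)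
      (fun s hs ↦ ?_) haI hbI hab).trans_lt (half_lt_self hε)
    exact (mem_ball_iff_norm.mp (hρball (hB s hs)).2.2.1).le
  have hwb : w a + (b - a) • v = w b := by
    simp only [v]
    rw [smul_inv_smul₀ hba.ne']
    abel
  have hseg : ∀ s ∈ Icc a b, w a + (s - a) • v ∈ Metric.ball (w s₀) ε := by
    intro s hs
    have h4 : w a + ((s - a) / (b - a)) • (w b - w a) ∈ Metric.ball (w s₀) ε :=
      (convex_ball (w s₀) ε).add_smul_sub_mem (hρball (hB a haI)).2.1 (hρball (hB b hbI)).2.1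
        ⟨div_nonneg (sub_nonneg.mpr hs.1) hba.le,
          (div_le_one hba).mpr (sub_le_sub_right hs.2 a)⟩
    rwa [div_eq_mul_inv, mul_smul] at h4
  have hz : ∀ r ∈ Icc 0 (k * ((b - a) / 2)), ∀ s ∈ Icc a b,
      ((r, w a + (s - a) • v, v) : ℝ × E × E) ∈ Metric.ball ((0 : ℝ), w s₀, v₀) ε := by
    intro r hr s hs
    rw [Metric.mem_ball, Prod.dist_eq, Prod.dist_eq, max_lt_iff, max_lt_iff]
    refine ⟨?_, hseg s hs, by rwa [dist_eq_norm]⟩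
    rw [Real.dist_eq, sub_zero, abs_of_nonneg hr.1]
    exact hr.2.trans_lt (hkR.trans_le (min_le_left _ _))
  have hr0 : (0 : ℝ) ∈ Icc 0 (k * ((b - a) / 2)) := ⟨le_rfl, by positivity⟩
  have hchain := causalChain_zigzag h hJ hne f hf hpos φ t (x s₀) hk hab (w a) v
    (fun s hs ↦ (hball _ (hz 0 hr0 s hs)).2.2)
    (fun r hr ↦ (hball _ (hz r hr a haI)).2.1)
    (fun r hr s hs ↦ (hball _ (hz r hr s hs)).1.le)
  rw [hwb] at hchain
  have hinv : ∀ s ∈ Icc a b, c.symm (w s) = x s :=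
    fun s hs ↦ c.left_inv (hρball (hB s hs)).1.1
  rw [hinv a haI, hinv b hbI] at hchain
  refine hchain.mono ?_
  have hrpos : 0 ≤ k * ((b - a) / 2) := by positivity
  have hφle := hφball (k * ((b - a) / 2)) (by
    rw [Metric.mem_ball, Real.dist_eq, sub_zero, abs_of_nonneg hrpos]
    exact hkR.trans_le (min_le_right _ _))
  rw [abs_of_nonneg hrpos] at hφle
  calc 2 * ENNReal.ofReal |φ (t + k * ((b - a) / 2)) - φ t|
      ≤ ENNReal.ofReal 2 * ENNReal.ofReal (P * (k * ((b - a) / 2))) := by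
        rw [ENNReal.ofReal_ofNat]
        gcongr
    _ = ENNReal.ofReal P * (ENNReal.ofReal k * ENNReal.ofReal (b - a)) := by
        rw [← ENNReal.ofReal_mul hk.le, ← ENNReal.ofReal_mul hPpos.le,
          ← ENNReal.ofReal_mul zero_le_two]
        congr 1
        ring
    _ = ENNReal.ofReal P * ∫⁻ _ in Ioc a b, ENNReal.ofReal k := by
        rw [setLIntegral_const, Real.volume_Ioc]
    _ ≤ _ := by
        refine mul_le_mul_right (setLIntegral_mono' measurableSet_Ioc fun s hs ↦ ?_) _
        have hsI : s ∈ Icc a b := Ioc_subset_Icc_self hs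
        have h4 : W s₀ - δ / 2 < W s := (hρball (hB s hsI)).2.2.2
        refine le_trans (ENNReal.ofReal_le_ofReal ?_) ENNReal.ofReal_add_le
        change k ≤ W s + δ
        simp only [k]
        linarith

end LevelSets

end NullDist

/-! ### Comparison of the null distance with the induced distance -/

namespace NullDist

section LevelSets

variable {E : Type*} [NormedAddCommGroup E] [NormedSpace ℝ E]
  {S : Type*} [TopologicalSpace S] [ChartedSpace E S] [IsManifold 𝓘(ℝ, E) ∞ S]
  {J : TopologicalSpace.Opens ℝ}

theorem time_eq_of_mem_level (hJ : (J : Set ℝ).OrdConnected) {φ : ℝ → ℝ}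
    (hφ : ContDiffOn ℝ ∞ φ J) (hφ' : ∀ t ∈ J, 0 < deriv φ t) {t : J} {p : J × S}
    (hp : φ p.1 = φ t) : p.1 = t :=
  Subtype.ext ((strictMonoOn_of_deriv_pos_opens hJ hφ hφ').injOn p.1.2 t.2 hp)

variable
  (h : ContMDiffRiemannianMetric 𝓘(ℝ, E) ∞ E (fun x : S ↦ TangentSpace 𝓘(ℝ, E) x))
  [FiniteDimensional ℝ E] [ConnectedSpace S]
  (hJ : (J : Set ℝ).OrdConnected) (hne : (J : Set ℝ).Nonempty)
  (f : ℝ → ℝ) (hf : ContDiffOn ℝ ∞ f J) (hpos : ∀ t ∈ J, 0 < f t)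

/-- For a curve in the slice `{t} × S`, the `g`-norm of the velocity is `f(t)` times the `h`-norm of
the velocity of its projection to `S`. -/
theorem grw_norm_velocity_of_time_eq {t : J} {γ : ℝ → J × S} {a b s : ℝ} (hab : a < b)
    (hs : s ∈ Icc a b) (hγt : ∀ s ∈ Icc a b, (γ s).1 = t)
    (hγ : MDifferentiableWithinAt 𝓘(ℝ, ℝ) (𝓘(ℝ, ℝ).prod 𝓘(ℝ, E)) γ (Icc a b) s) :
    (grw J hJ hne f hf hpos h).norm (velocity (𝓘(ℝ, ℝ).prod 𝓘(ℝ, E)) γ a b s) =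
      f t * √(h.inner (γ s).2 (velocity 𝓘(ℝ, E) (fun s ↦ (γ s).2) a b s)
        (velocity 𝓘(ℝ, E) (fun s ↦ (γ s).2) a b s)) := by
  have hdt : dt (γ s) (velocity (𝓘(ℝ, ℝ).prod 𝓘(ℝ, E)) γ a b s) = 0 := by
    rw [dt_velocity hab hs hγ, derivWithin_congr (f := fun _ ↦ (t : ℝ))
      (fun r hr ↦ congrArg Subtype.val (hγt r hr)) (congrArg Subtype.val (hγt s hs))]
    simp
  unfold Spacetime.norm
  rw [grw_val_apply, hdt, dx_velocity hab hs hγ, hγt s hs, mul_zero, neg_zero, zero_add,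
    abs_of_nonneg (mul_nonneg (sq_nonneg _) (inner_self_nonneg h _ _)), Real.sqrt_mul (sq_nonneg _),
    Real.sqrt_sq (hpos t t.2).le]

theorem grw_nullDist_le_lintegral {φ : ℝ → ℝ} (hφ : ContDiffOn ℝ ∞ φ J)
    (hφ' : ∀ t ∈ J, 0 < deriv φ t) {t : J} {γ : ℝ → J × S}
    (hγ : ContMDiffOn 𝓘(ℝ, ℝ) (𝓘(ℝ, ℝ).prod 𝓘(ℝ, E)) 1 γ (Icc 0 1))
    (hγt : ∀ s ∈ Icc (0 : ℝ) 1, (γ s).1 = t) :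
    (grw J hJ hne f hf hpos h).nullDist (fun p : J × S ↦ φ p.1) (γ 0) (γ 1) ≤
      ENNReal.ofReal (deriv φ t) * ∫⁻ s in Icc (0 : ℝ) 1, ENNReal.ofReal
        ((grw J hJ hne f hf hpos h).norm (velocity (𝓘(ℝ, ℝ).prod 𝓘(ℝ, E)) γ 0 1 s)) := by
  let x : ℝ → S := fun s ↦ (γ s).2
  let W : ℝ → ℝ := fun s ↦ f t * √(h.inner (x s) (velocity 𝓘(ℝ, E) x 0 1 s)
    (velocity 𝓘(ℝ, E) x 0 1 s))
  have hx : ContMDiffOn 𝓘(ℝ, ℝ) 𝓘(ℝ, E) 1 x (Icc 0 1) := contMDiff_snd.comp_contMDiffOn hγ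
  have hI : ∫⁻ s in Icc (0 : ℝ) 1, ENNReal.ofReal
        ((grw J hJ hne f hf hpos h).norm (velocity (𝓘(ℝ, ℝ).prod 𝓘(ℝ, E)) γ 0 1 s)) =
      ∫⁻ s in Ioc (0 : ℝ) 1, ENNReal.ofReal (W s) := by
    rw [setLIntegral_congr Ioc_ae_eq_Icc.symm]
    refine setLIntegral_congr_fun measurableSet_Ioc fun s hs ↦ congrArg ENNReal.ofReal ?_
    have hs := Ioc_subset_Icc_self hs
    exact grw_norm_velocity_of_time_eq h hJ hne f hf hpos zero_lt_one hs hγt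
      (hγ.mdifferentiableOn (by simp) s hs)
  rw [hI]
  have key : ∀ δ : ℝ, 0 < δ →
      (grw J hJ hne f hf hpos h).nullDist (fun p : J × S ↦ φ p.1) (γ 0) (γ 1) ≤
        ENNReal.ofReal (deriv φ t + δ) *
          ((∫⁻ s in Ioc (0 : ℝ) 1, ENNReal.ofReal (W s)) + ENNReal.ofReal δ) := by
    intro δ hδ
    -- The curve `(t, x s)` need agree with `γ` only on `[0, 1]`; just the endpoints are compared.
    have hch := Spacetime.CausalChain.of_local (g := grw J hJ hne f hf hpos h)
      (τ := fun p : J × S ↦ φ p.1) (γ := fun s ↦ (t, x s)) (zero_lt_one' ℝ) fun s₀ hs₀ ↦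
        causalChain_local h hJ hne f hf hpos hφ hφ' t (P := deriv φ t + δ) (by linarith) hδ
          zero_lt_one hs₀ hx
    have h0 : (t, x 0) = γ 0 := Prod.ext (hγt 0 (by simp)).symm rfl
    have h1 : (t, x 1) = γ 1 := Prod.ext (hγt 1 (by simp)).symm rfl
    have hle := hch.nullDist_le
    rw [h0, h1, lintegral_add_right _ measurable_const, setLIntegral_const, Real.volume_Ioc] at hle
    simpa using hle
  -- An infinite integral makes the bound trivial because `φ'(t) ≠ 0`; a finite one makes
  -- multiplication continuous at the limit as `δ → 0`.
  by_cases htop : ∫⁻ s in Ioc (0 : ℝ) 1, ENNReal.ofReal (W s) = ⊤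
  · rw [htop, ENNReal.mul_top (ENNReal.ofReal_pos.mpr (hφ' t t.2)).ne']
    exact le_top
  · have hid : Filter.Tendsto (fun δ : ℝ ↦ δ) (𝓝[>] 0) (𝓝 0) := nhdsWithin_le_nhds
    have hl1 : Filter.Tendsto (fun δ : ℝ ↦ ENNReal.ofReal (deriv φ t + δ)) (𝓝[>] 0)
        (𝓝 (ENNReal.ofReal (deriv φ t))) := by
      simpa using ENNReal.tendsto_ofReal (hid.const_add (deriv φ t))
    have hl2 : Filter.Tendsto (fun δ : ℝ ↦ (∫⁻ s in Ioc (0 : ℝ) 1, ENNReal.ofReal (W s)) +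
        ENNReal.ofReal δ) (𝓝[>] 0) (𝓝 (∫⁻ s in Ioc (0 : ℝ) 1, ENNReal.ofReal (W s))) := by
      simpa using (ENNReal.tendsto_ofReal hid).const_add
        (∫⁻ s in Ioc (0 : ℝ) 1, ENNReal.ofReal (W s))
    refine ge_of_tendsto (ENNReal.Tendsto.mul hl1 (Or.inr htop) hl2
      (Or.inr ENNReal.ofReal_ne_top)) ?_
    filter_upwards [self_mem_nhdsWithin] with δ hδ using key δ hδ

theorem grw_nullDist_le_inducedDist {φ : ℝ → ℝ} (hφ : ContDiffOn ℝ ∞ φ J)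
    (hφ' : ∀ t ∈ J, 0 < deriv φ t) (t : J) (p q : J × S) :
    (grw J hJ hne f hf hpos h).nullDist (fun p : J × S ↦ φ p.1) p q ≤
      ENNReal.ofReal (deriv φ t) * (grw J hJ hne f hf hpos h).inducedDist
        ((fun p : J × S ↦ φ p.1) ⁻¹' {φ t}) p q := by
  have h0 : ENNReal.ofReal (deriv φ t) ≠ 0 := (ENNReal.ofReal_pos.mpr (hφ' t t.2)).ne'
  -- Dividing by the positive finite constant `φ'(t)` isolates the infimum, so it suffices to treat
  -- each curve separately.
  rw [← ENNReal.div_le_iff' h0 ENNReal.ofReal_ne_top]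
  refine le_sInf ?_
  rintro L ⟨γ, hγ, hγN, rfl, rfl, rfl⟩
  rw [ENNReal.div_le_iff' h0 ENNReal.ofReal_ne_top]
  exact grw_nullDist_le_lintegral h hJ hne f hf hpos hφ hφ' hγ
    fun s hs ↦ time_eq_of_mem_level hJ hφ hφ' (hγN s hs)

end LevelSets

end NullDist


/-- In the spacetime `(J × S, -dt² + f(t)² h)`, let `τ(t, x) = φ(t)` with `φ` smooth and `φ' > 0`.
Then `τ` is a smooth temporal function, `g(∇τ, ∇τ) = -φ'(t)²`, each level set
`M_t = τ⁻¹(φ(t)) = {t} × S` is spacelike, and the null distance on `M_t` is at most `φ'(t)` times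
the distance of the induced Riemannian metric. -/
theorem mainTheorem3
    {E : Type*} [NormedAddCommGroup E] [NormedSpace ℝ E] [FiniteDimensional ℝ E]
    {S : Type*} [TopologicalSpace S] [ChartedSpace E S] [IsManifold 𝓘(ℝ, E) ∞ S]
    [T2Space S] [SecondCountableTopology S] [ConnectedSpace S]
    (J : TopologicalSpace.Opens ℝ) (hJ : (J : Set ℝ).OrdConnected) (hne : (J : Set ℝ).Nonempty)
    (f : ℝ → ℝ) (hf : ContDiffOn ℝ ∞ f J) (hpos : ∀ t ∈ J, 0 < f t)
    (h : ContMDiffRiemannianMetric 𝓘(ℝ, E) ∞ E (fun x : S ↦ TangentSpace 𝓘(ℝ, E) x))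
    (φ : ℝ → ℝ) (hφ : ContDiffOn ℝ ∞ φ J) (hφ' : ∀ t ∈ J, 0 < deriv φ t)
    (g : NullDist.Spacetime (𝓘(ℝ, ℝ).prod 𝓘(ℝ, E)) (J × S))
    (hg : g = NullDist.grw J hJ hne f hf hpos h)
    (τ : J × S → ℝ) (hτ : ∀ p, τ p = φ p.1) :
    ContMDiff (𝓘(ℝ, ℝ).prod 𝓘(ℝ, E)) 𝓘(ℝ, ℝ) ∞ τ ∧ g.IsTemporal τ ∧
      ∀ t : J,
        (∀ p ∈ τ ⁻¹' {φ t}, ∀ V, g.IsGradientAt τ p V → g.val p V V = -(deriv φ t) ^ 2) ∧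
        (∀ p ∈ τ ⁻¹' {φ t}, ∀ X : TangentSpace (𝓘(ℝ, ℝ).prod 𝓘(ℝ, E)) p,
          mfderiv (𝓘(ℝ, ℝ).prod 𝓘(ℝ, E)) 𝓘(ℝ, ℝ) τ p X = 0 → X ≠ 0 → 0 < g.val p X X) ∧
        ∀ p ∈ τ ⁻¹' {φ t}, ∀ q ∈ τ ⁻¹' {φ t},
          g.nullDist τ p q ≤ ENNReal.ofReal (deriv φ t) * g.inducedDist (τ ⁻¹' {φ t}) p q := by
  subst hg
  obtain rfl : τ = fun p ↦ φ p.1 := funext hτ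
  refine ⟨NullDist.contMDiff_comp_time hφ, NullDist.grw_isTemporal J hJ hne f hf hpos h hφ hφ',
    fun t ↦ ⟨fun p hp V hV ↦ ?_, fun p _ X hX hX0 ↦ ?_, fun p _ q _ ↦ ?_⟩⟩
  · rw [NullDist.grw_val_gradient J hJ hne f hf hpos h hφ hV,
      NullDist.time_eq_of_mem_level hJ hφ hφ' hp]
  -- Since `dτ = φ' dt` with `φ' ≠ 0`, vectors tangent to the level set have `dt(X) = 0`.
  · rw [(NullDist.hasMFDerivAt_comp_time hφ p).mfderiv] at hX
    exact NullDist.grw_val_pos_of_dt_eq_zero J hJ hne f hf hpos h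
      ((mul_eq_zero.mp hX).resolve_left (hφ' p.1 p.1.2).ne') hX0
  · exact NullDist.grw_nullDist_le_inducedDist h hJ hne f hf hpos hφ hφ' t p q
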